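/- Let $C$ be a copula on $\mathbb R^d$, i.e. the distribution function of a probability measure on $\mathbb R^d$ whose one-dimensional margins are uniform on $[0,1]$, and let $\|\cdot\|_D$ be a $D$-norm on $\mathbb R^d$, i.e. $\|x\|_D=E(\max_{1\le i\le d}|x_i|Z_i)$ for a random vector $Z=(Z_1,\dots,Z_d)$ with $Z_i\ge 0$ and $E(Z_i)=1$ for all $i$. Let $U^{(1)},U^{(2)},\dots$ be independent random vectors with distribution function $C$, and let $M^{(n)}=(M^{(n)}_1,\dots,M^{(n)}_d)$ with $M^{(n)}_j=\max_{1\le i\le n}U^{(i)}_j$ be the vector of componentwise maxima. Write $\mathbf 1=(1,\dots,1)$. Suppose that (i) $C(u)=1-\|\mathbf 1-u\|_D+o(\|\mathbf 1-u\|)$ as $u\to\mathbf 1$, $u\in[0,1]^d$; and (ii) for every nonempty set of indices $\{i_1<\dots<i_k\}\subseteq\{1,\dots,d\}$ and every $x\in\mathbb R^d$ with all components negative, the partial derivative $\frac{\partial^k}{\partial x_{i_1}\cdots\partial x_{i_k}}\|x\|_D$ exists, the partial derivative $\frac{\partial^k}{\partial x_{i_1}\cdots\partial x_{i_k}}\,n\bigl(C(\mathbf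 1+x/n)-1\bigr)$ exists for all sufficiently large $n$, and $$\frac{\partial^k}{\partial x_{i_1}\cdots\partial x_{i_k}}\,n\bigl(C(\mathbf 1+x/n)-1\bigr)\longrightarrow-\frac{\partial^k}{\partial x_{i_1}\cdots\partial x_{i_k}}\|x\|_D\qquad(n\to\infty).$$ Then there is a probability measure $G$ on $\mathbb R^d$ with distribution function $G(x)=\exp(-\|x\|_D)$ for $x\le 0$ (componentwise), and $$\sup_{A\in\mathbb B^d}\bigl|P\bigl(n(M^{(n)}-\mathbf 1)\in A\bigr)-G(A)\bigr|\longrightarrow 0\qquad(n\to\infty),$$ where $\mathbb B^d$ is the Borel $\sigma$-field of $\mathbb R^d$. -/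

import Mathlib

open Filter Topology MeasureTheory ProbabilityTheory Asymptotics

/-- `C` is a copula on `ℝ^d`: the distribution function of a Borel probability measure on `ℝ^d`
all of whose one-dimensional margins are uniform on `[0,1]`. -/
def IsCopula {d : ℕ} (C : (Fin d → ℝ) → ℝ) : Prop :=
  ∃ μ : Measure (Fin d → ℝ), IsProbabilityMeasure μ ∧
    (∀ j, μ.map (fun u => u j) = (volume : Measure ℝ).restrict (Set.Icc 0 1)) ∧
    ∀ u, C u = μ.real (Set.Iic u)

/-- `N` is a `D`-norm on `ℝ^d`: `N x = E (max_j |x_j| Z_j)` for a random vector `Z` with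
nonnegative components of mean one. The existential is over the law `ν` of `Z`. -/
def IsDNorm {d : ℕ} (N : (Fin d → ℝ) → ℝ) : Prop :=
  ∃ ν : Measure (Fin d → ℝ), IsProbabilityMeasure ν ∧
    (∀ j, (∀ᵐ z ∂ν, 0 ≤ z j) ∧ Integrable (fun z => z j) ν ∧ ∫ z, z j ∂ν = 1) ∧
    ∀ x, N x = ∫ z, (⨆ j, |x j| * z j) ∂ν

/-- `C u = 1 - N (1 - u) + o(‖1 - u‖)` as `u → 1` within `[0,1]^d`. -/
def HasTailExpansion {d : ℕ} (C N : (Fin d → ℝ) → ℝ) : Prop :=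
  (fun u => C u - (1 - N (1 - u))) =o[𝓝[Set.Icc 0 1] 1] (fun u : Fin d → ℝ => 1 - u)

/-- `HasMixedPartial f [i₁, …, iₖ] x v` says that the iterated partial derivative
`∂/∂x_{i₁} ⋯ ∂/∂x_{iₖ} f` (innermost derivative in `x_{iₖ}`) exists at `x` and equals `v`:
the inner derivative has to exist at all points near `x` on the line through `x` in the direction
of the next variable, and to be differentiable along that line. -/
def HasMixedPartial {d : ℕ} (f : (Fin d → ℝ) → ℝ) :
    List (Fin d) → (Fin d → ℝ) → ℝ → Prop
  | [], x, v => f x = v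
  | i :: l, x, v => ∃ g : ℝ → ℝ,
      (∀ᶠ t in 𝓝 (x i), HasMixedPartial f l (Function.update x i t) (g t)) ∧
        HasDerivAt g v (x i)

/-- For each nonempty block `B = {i₁ < ⋯ < iₖ}` of indices and each `x` with all components
negative, `∂^k/∂x_{i₁}⋯∂x_{iₖ} n (C (1 + x/n) - 1)` (which exists for all large `n`) tends to
`∂^k/∂x_{i₁}⋯∂x_{iₖ} (- N x)` (which exists) as `n → ∞`. -/
def MixedPartialsConverge {d : ℕ} (C N : (Fin d → ℝ) → ℝ) : Prop :=
  ∀ B : Finset (Fin d), B.Nonempty → ∀ x : Fin d → ℝ, (∀ j, x j < 0) →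
    ∃ (v : ℕ → ℝ) (w : ℝ),
      (∀ᶠ n : ℕ in atTop,
        HasMixedPartial (fun y => (n : ℝ) * (C (fun j => 1 + y j / n) - 1)) (B.sort (· ≤ ·)) x
          (v n)) ∧
      HasMixedPartial (fun y => - N y) (B.sort (· ≤ ·)) x w ∧
      Tendsto v atTop (𝓝 w)

/-- The componentwise maximum of the first `n` of the random vectors `U 0, U 1, …`. -/
noncomputable def componentwiseMax {Ω : Type*} {d : ℕ} (U : ℕ → Ω → (Fin d → ℝ)) (n : ℕ) (ω : Ω) :
    Fin d → ℝ :=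
  fun j => ⨆ i : Fin n, U i ω j

/-! ### Iterated partial derivatives, box differences and iterated limits. -/

section MixedPartial

variable {d : ℕ}

/-! Write `μ n` for the law of `n (M⁽ⁿ⁾ - 1)` and `φ n x = n (C (1 + x/n) - 1)`. On the negative
orthant the distribution function of `μ n` is `(1 + φ n / n) ^ n`. The tail expansion gives `φ n →
-N`, so these functions converge to `E = exp (-N)`. By Faà di Bruno's formula their full mixed
partials are finite sums of products of derivatives of `s ↦ (1 + s/n) ^ n` and of mixed partials of
`φ n`. All these factors converge, so the full mixed partials converge pointwise to that of `E`, and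
a Scheffé argument should give convergence in total variation.

The difficulty is that mixed partials exist only pointwise, for `n` large depending on the point,
and are not assumed continuous. Nothing says that `μ n` is absolutely continuous or that its mixed
partial is a density. Two facts replace this.

(1) The iterated lower limit of `μ(box) / volume(box)` is defined everywhere, is measurable, and
equals the mixed partial wherever that exists (`lowerDensity_eq_of_hasMixedPartial`). By Tonelli and
Fatou its integral over any Borel set `A` is at most `μ A` (`setLIntegral_lowerDensity_le`).

(2) For the limit an exact identity holds. Box differences of `E` are limits of measures of boxes,
hence nonnegative. An everywhere existing nonnegative derivative is integrable and satisfies the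
fundamental theorem of calculus, so integrating out one variable at a time recovers the box
differences of `E` (`setLIntegral_mixedPartial`). Exhausting orthants by boxes, with `E z ≤ exp (z
i)` to discard the far corners, gives the distribution function `E` and total mass `E 0 = 1`
(`limitLaw_Iic`).

The one-sided Scheffé bound `G A ≤ ∫ (g - gₙ)⁺ + μ n A` needs only that `gₙ` is a subdensity of `μ
n`. Applied to complements as well, it bounds the total variation (`tendsto_iSup_abs_sub_limitLaw`).
-/

theorem HasMixedPartial.unique {f : (Fin d → ℝ) → ℝ} : ∀ {l : List (Fin d)} {x : Fin d → ℝ}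
    {v w : ℝ}, HasMixedPartial f l x v → HasMixedPartial f l x w → v = w
  | [], _, _, _, hv, hw => hv.symm.trans hw
  | i :: l, x, v, w, ⟨g, hg, hg'⟩, ⟨k, hk, hk'⟩ => by
    have h : g =ᶠ[𝓝 (x i)] k := by
      filter_upwards [hg, hk] with t ht ht'
      exact ht.unique ht'
    exact hg'.unique (hk'.congr_of_eventuallyEq h)

open Classical in
/-- The value of the iterated partial derivative, where it exists. -/
noncomputable def mixedPartial (f : (Fin d → ℝ) → ℝ) (l : List (Fin d)) (x : Fin d → ℝ) : ℝ :=
  if h : ∃ v, HasMixedPartial f l x v then h.choose else 0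

theorem HasMixedPartial.mixedPartial_eq {f : (Fin d → ℝ) → ℝ} {l : List (Fin d)} {x : Fin d → ℝ}
    {v : ℝ} (h : HasMixedPartial f l x v) : mixedPartial f l x = v := by
  have h' : ∃ v, HasMixedPartial f l x v := ⟨v, h⟩
  rw [mixedPartial, dif_pos h']
  exact h'.choose_spec.unique h

theorem hasMixedPartial_mixedPartial {f : (Fin d → ℝ) → ℝ} {l : List (Fin d)} {x : Fin d → ℝ}
    (h : ∃ v, HasMixedPartial f l x v) : HasMixedPartial f l x (mixedPartial f l x) := by
  obtain ⟨v, hv⟩ := h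
  rwa [hv.mixedPartial_eq]

@[simp]
theorem mixedPartial_nil (f : (Fin d → ℝ) → ℝ) (x : Fin d → ℝ) : mixedPartial f [] x = f x :=
  HasMixedPartial.mixedPartial_eq (v := f x) (by rfl)

theorem HasMixedPartial.hasDerivAt_mixedPartial {f : (Fin d → ℝ) → ℝ} {i : Fin d}
    {l : List (Fin d)} {x : Fin d → ℝ} {v : ℝ} (h : HasMixedPartial f (i :: l) x v) :
    HasDerivAt (fun t => mixedPartial f l (Function.update x i t)) v (x i) := by
  obtain ⟨g, hg, hg'⟩ := h
  refine hg'.congr_of_eventuallyEq ?_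
  filter_upwards [hg] with t ht
  exact ht.mixedPartial_eq

theorem HasMixedPartial.sub {f k : (Fin d → ℝ) → ℝ} : ∀ {l : List (Fin d)} {x : Fin d → ℝ}
    {v w : ℝ}, HasMixedPartial f l x v → HasMixedPartial k l x w →
      HasMixedPartial (fun y => f y - k y) l x (v - w)
  | [], _, _, _, hv, hw => congrArg₂ (· - ·) hv hw
  | i :: l, x, v, w, ⟨g, hg, hg'⟩, ⟨m, hm, hm'⟩ =>
    ⟨fun t => g t - m t, by filter_upwards [hg, hm] with t ht ht' using ht.sub ht', hg'.sub hm'⟩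

theorem HasMixedPartial.comp_update {f : (Fin d → ℝ) → ℝ} {i : Fin d} {b : ℝ} :
    ∀ {l : List (Fin d)} {x : Fin d → ℝ} {v : ℝ}, i ∉ l →
      HasMixedPartial f l (Function.update x i b) v →
      HasMixedPartial (fun y => f (Function.update y i b)) l x v
  | [], _, _, _, hv => hv
  | k :: l, x, v, hi, ⟨g, hg, hg'⟩ => by
    have hki : k ≠ i := fun h => hi (by simp [h])
    rw [Function.update_of_ne hki] at hg hg'
    refine ⟨g, ?_, hg'⟩
    filter_upwards [hg] with t ht
    rw [Function.update_comm hki.symm] at ht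
    exact ht.comp_update (fun h => hi (List.mem_cons_of_mem _ h))

/-! ### Iterated differences -/

/-- The iterated difference of `f` between `a` and `b` in the coordinates listed. -/
def boxDiff (a b : Fin d → ℝ) (f : (Fin d → ℝ) → ℝ) : List (Fin d) → (Fin d → ℝ) → ℝ
  | [], x => f x
  | i :: l, x => boxDiff a b f l (Function.update x i (b i)) -
      boxDiff a b f l (Function.update x i (a i))

theorem boxDiff_append (a b : Fin d → ℝ) (f : (Fin d → ℝ) → ℝ) (l p : List (Fin d))
    (x : Fin d → ℝ) : boxDiff a b f (l ++ p) x = boxDiff a b (boxDiff a b f p) l x := by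
  induction l generalizing x with
  | nil => rfl
  | cons i l ih => simp only [List.cons_append, boxDiff, ih]

theorem boxDiff_congr {a b a' b' : Fin d → ℝ} (f : (Fin d → ℝ) → ℝ) {l : List (Fin d)}
    (ha : ∀ j ∈ l, a j = a' j) (hb : ∀ j ∈ l, b j = b' j) (x : Fin d → ℝ) :
    boxDiff a b f l x = boxDiff a' b' f l x := by
  induction l generalizing x with
  | nil => rfl
  | cons i l ih =>
    simp only [List.forall_mem_cons] at ha hb
    simp only [boxDiff, ih ha.2 hb.2, ha.1, hb.1]

theorem tendsto_boxDiff {ι : Type*} {F : Filter ι} {a b : Fin d → ℝ} {f : ι → (Fin d → ℝ) → ℝ}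
    {f₀ : (Fin d → ℝ) → ℝ} (hf : ∀ x ≤ 0, Tendsto (fun n => f n x) F (𝓝 (f₀ x)))
    (ha : a ≤ 0) (hb : b ≤ 0) (l : List (Fin d)) {x : Fin d → ℝ} (hx : x ≤ 0) :
    Tendsto (fun n => boxDiff a b (f n) l x) F (𝓝 (boxDiff a b f₀ l x)) := by
  induction l generalizing x with
  | nil => exact hf x hx
  | cons i l ih =>
    refine (ih ?_).sub (ih ?_)
    · exact update_le_iff.2 ⟨hb i, fun j _ => hx j⟩
    · exact update_le_iff.2 ⟨ha i, fun j _ => hx j⟩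

/-- Each of the `2 ^ l.length` corners keeps `i`-th coordinate `a i`, because `i` is not among the
differenced coordinates. -/
theorem abs_boxDiff_le {a b : Fin d → ℝ} {f : (Fin d → ℝ) → ℝ} {c : ℝ} (l : List (Fin d))
    {i : Fin d} (hi : i ∉ l) (hf : ∀ z ≤ 0, z i = a i → |f z| ≤ c) (ha : a ≤ 0) (hb : b ≤ 0)
    {x : Fin d → ℝ} (hx : x ≤ 0) (hxi : x i = a i) : |boxDiff a b f l x| ≤ 2 ^ l.length * c := by
  induction l generalizing x with
  | nil => simpa [boxDiff] using hf x hx hxi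
  | cons k l ih =>
    simp only [List.mem_cons, not_or] at hi
    have h1 := ih hi.2 (x := Function.update x k (b k))
      (update_le_iff.2 ⟨hb k, fun j _ => hx j⟩) (by rwa [Function.update_of_ne hi.1])
    have h2 := ih hi.2 (x := Function.update x k (a k))
      (update_le_iff.2 ⟨ha k, fun j _ => hx j⟩) (by rwa [Function.update_of_ne hi.1])
    simp only [boxDiff, List.length_cons, pow_succ]
    rw [abs_le] at *
    constructor <;> linarith

theorem boxDiff_measureReal (ν : Measure (Fin d → ℝ)) [IsFiniteMeasure ν] {a b : Fin d → ℝ}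
    (hab : a ≤ b) {l : List (Fin d)} (hl : l.Nodup) (x : Fin d → ℝ) :
    boxDiff a b (fun y => ν.real (Set.Iic y)) l x =
      ν.real {y | ∀ j, (j ∈ l → y j ∈ Set.Ioc (a j) (b j)) ∧ (j ∉ l → y j ≤ x j)} := by
  induction l generalizing x with
  | nil => simp [boxDiff, Set.Iic, Pi.le_def]
  | cons i l ih =>
    rw [List.nodup_cons] at hl
    rw [boxDiff, ih hl.2, ih hl.2, ← measureReal_sdiff]
    · congr 1
      ext y
      simp only [Set.mem_sdiff, Set.mem_ofPred_eq, List.mem_cons, not_or]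
      constructor
      · rintro ⟨h1, h2⟩ j
        by_cases hji : j = i
        · subst hji
          refine ⟨fun _ => ⟨?_, by simpa using (h1 j).2 hl.1⟩, fun h => absurd rfl h.1⟩
          by_contra hc
          refine h2 fun k => ⟨(h1 k).1, fun hk => ?_⟩
          by_cases hkj : k = j
          · subst hkj; simpa using hc
          · simpa [hkj] using (h1 k).2 hk
        · refine ⟨fun h => (h1 j).1 (h.resolve_left hji), fun h => ?_⟩
          simpa [hji] using (h1 j).2 h.2
      · refine fun h => ⟨fun j => ⟨fun hj => (h j).1 (Or.inr hj), fun hj => ?_⟩, fun h2 => ?_⟩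
        · by_cases hji : j = i
          · subst hji; simpa using ((h j).1 (Or.inl rfl)).2
          · simpa [hji] using (h j).2 ⟨hji, hj⟩
        · have h3 := (h2 i).2 hl.1
          have h4 := ((h i).1 (Or.inl rfl)).1
          simp only [Function.update_self] at h3
          exact absurd h4 (not_lt.2 h3)
    · intro y hy j
      refine ⟨(hy j).1, fun hj => ((hy j).2 hj).trans ?_⟩
      by_cases hji : j = i
      · subst hji; simpa using hab j
      · simp [hji]
    · simp only [Set.ofPred_forall, Set.ofPred_and, Set.mem_Ioc]
      refine MeasurableSet.iInter fun j => ?_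
      have hm := measurable_pi_apply (X := fun _ : Fin d => ℝ) j
      refine .inter (.iInter fun _ => ?_) (.iInter fun _ => measurableSet_le hm measurable_const)
      exact (measurableSet_lt measurable_const hm).inter (measurableSet_le hm measurable_const)

theorem boxDiff_measureReal_nonneg (ν : Measure (Fin d → ℝ)) [IsFiniteMeasure ν]
    {a b : Fin d → ℝ} (hab : a ≤ b) {l : List (Fin d)} (hl : l.Nodup) (x : Fin d → ℝ) :
    0 ≤ boxDiff a b (fun y => ν.real (Set.Iic y)) l x := by
  rw [boxDiff_measureReal ν hab hl]
  exact measureReal_nonneg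

/-- A box difference is a signed sum of copies of `f` with the coordinates in `p` frozen, and
freezing commutes with differentiation in the other coordinates. -/
theorem hasMixedPartial_boxDiff {a b : Fin d → ℝ} (ha : ∀ j, a j < 0) (hb : ∀ j, b j < 0)
    {f g : (Fin d → ℝ) → ℝ} {l : List (Fin d)}
    (h : ∀ x, (∀ j, x j < 0) → HasMixedPartial f l x (g x)) {p : List (Fin d)}
    (hp : l.Disjoint p) {x : Fin d → ℝ} (hx : ∀ j, x j < 0) :
    HasMixedPartial (boxDiff a b f p) l x (boxDiff a b g p x) := by
  have key (x : Fin d → ℝ) (hx : ∀ j, x j < 0) (i : Fin d) (c : ℝ) (hc : c < 0) :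
      ∀ j, Function.update x i c j < 0 := fun j => by
    by_cases hj : j = i
    · subst hj; simpa
    · simpa [hj] using hx j
  induction p generalizing x with
  | nil => exact h x hx
  | cons i p ih =>
    rw [List.disjoint_cons_right] at hp
    exact ((ih hp.2 (key x hx i _ (hb i))).comp_update hp.1).sub
      ((ih hp.2 (key x hx i _ (ha i))).comp_update hp.1)

theorem hasDerivAt_boxDiff {a b : Fin d → ℝ} (ha : ∀ j, a j < 0) (hb : ∀ j, b j < 0)
    {g g' : (Fin d → ℝ) → ℝ} {k : Fin d}
    (h : ∀ x, (∀ j, x j < 0) → HasDerivAt (fun t => g (Function.update x k t)) (g' x) (x k))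
    {p : List (Fin d)} (hp : k ∉ p) {x : Fin d → ℝ} (hx : ∀ j, x j < 0) :
    HasDerivAt (fun t => boxDiff a b g p (Function.update x k t)) (boxDiff a b g' p x) (x k) := by
  have key (x : Fin d → ℝ) (hx : ∀ j, x j < 0) (i : Fin d) (c : ℝ) (hc : c < 0) :
      ∀ j, Function.update x i c j < 0 := fun j => by
    by_cases hj : j = i
    · subst hj; simpa
    · simpa [hj] using hx j
  induction p generalizing x with
  | nil => exact h x hx
  | cons i p ih =>
    simp only [List.mem_cons, not_or] at hp
    have h1 := ih hp.2 (key x hx i _ (hb i))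
    have h2 := ih hp.2 (key x hx i _ (ha i))
    rw [Function.update_of_ne hp.1] at h1 h2
    refine (h1.sub h2).congr_of_eventuallyEq (.of_forall fun t => ?_)
    simp only [boxDiff, Pi.sub_apply, Function.update_comm hp.1]

/-! ### Iterated limits of difference quotients -/

/-- `Q` tends to `v` when the coordinates of `h` listed tend to `0` along `1 / (n + 1)`, one after
the other, the last one first. -/
def HasIterLim (Q : (Fin d → ℝ) → ℝ) : List (Fin d) → (Fin d → ℝ) → ℝ → Prop
  | [], h, v => Q h = v
  | i :: l, h, v => ∃ g : ℕ → ℝ,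
      (∀ᶠ n : ℕ in atTop, HasIterLim Q l (Function.update h i (1 / ((n : ℝ) + 1))) (g n)) ∧
        Tendsto g atTop (𝓝 v)

/-- The iterated lower limit corresponding to `HasIterLim`. -/
noncomputable def iterLiminf (Q : (Fin d → ℝ) → ENNReal) : List (Fin d) → (Fin d → ℝ) → ENNReal
  | [], h => Q h
  | i :: l, h =>
      liminf (fun n : ℕ => iterLiminf Q l (Function.update h i (1 / ((n : ℝ) + 1)))) atTop

theorem HasIterLim.iterLiminf_eq {Q : (Fin d → ℝ) → ℝ} : ∀ {l : List (Fin d)} {h : Fin d → ℝ}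
    {v : ℝ}, HasIterLim Q l h v → iterLiminf (fun h => ENNReal.ofReal (Q h)) l h = ENNReal.ofReal v
  | [], _, _, hv => congrArg ENNReal.ofReal hv
  | i :: l, h, v, ⟨g, hg, hg'⟩ => by
    refine Tendsto.liminf_eq ((ENNReal.tendsto_ofReal hg').congr' ?_)
    filter_upwards [hg] with n hn
    exact hn.iterLiminf_eq.symm

theorem HasIterLim.sub {Q R : (Fin d → ℝ) → ℝ} : ∀ {l : List (Fin d)} {h : Fin d → ℝ}
    {v w : ℝ}, HasIterLim Q l h v → HasIterLim R l h w →
      HasIterLim (fun h => Q h - R h) l h (v - w)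
  | [], _, _, _, hv, hw => congrArg₂ (· - ·) hv hw
  | i :: l, h, v, w, ⟨g, hg, hg'⟩, ⟨m, hm, hm'⟩ =>
    ⟨fun t => g t - m t, by filter_upwards [hg, hm] with t ht ht' using ht.sub ht', hg'.sub hm'⟩

theorem HasIterLim.const_mul {Q : (Fin d → ℝ) → ℝ} (c : ℝ) : ∀ {l : List (Fin d)}
    {h : Fin d → ℝ} {v : ℝ}, HasIterLim Q l h v → HasIterLim (fun h => c * Q h) l h (c * v)
  | [], _, _, hv => congrArg (c * ·) hv
  | i :: l, h, v, ⟨g, hg, hg'⟩ =>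
    ⟨fun t => c * g t, by filter_upwards [hg] with t ht using ht.const_mul c, hg'.const_mul c⟩

theorem HasIterLim.congr {Q R : (Fin d → ℝ) → ℝ} : ∀ {l : List (Fin d)} {h : Fin d → ℝ} {v : ℝ},
    HasIterLim Q l h v → (∀ h', (∀ j, j ∉ l → h' j = h j) → Q h' = R h') → HasIterLim R l h v
  | [], h, _, hv, hQ => (hQ h fun _ _ => rfl).symm.trans hv
  | i :: l, h, v, ⟨g, hg, hg'⟩, hQ => by
    refine ⟨g, ?_, hg'⟩
    filter_upwards [hg] with n hn
    refine hn.congr fun h' hh' => hQ h' fun j hj => ?_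
    simp only [List.mem_cons, not_or] at hj
    rw [hh' j hj.2, Function.update_of_ne hj.1]

theorem eventually_one_div_add_one_le {δ : ℝ} (hδ : 0 < δ) :
    ∀ᶠ n : ℕ in atTop, 1 / ((n : ℝ) + 1) ≤ δ :=
  (tendsto_one_div_add_atTop_nhds_zero_nat (𝕜 := ℝ)).eventually (eventually_le_nhds hδ)

/-- Only steps in `(0, δ]` matter, which lets boxes based at a point of the open orthant be kept
inside it. -/
theorem HasIterLim.nonneg {Q : (Fin d → ℝ) → ℝ} {δ : ℝ} (hδ : 0 < δ) : ∀ {l : List (Fin d)}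
    {h : Fin d → ℝ} {v : ℝ}, l.Nodup → HasIterLim Q l h v →
    (∀ h', (∀ j ∈ l, 0 < h' j ∧ h' j ≤ δ) → (∀ j, j ∉ l → h' j = h j) → 0 ≤ Q h') → 0 ≤ v
  | [], h, _, _, hv, hQ => (hQ h (by simp) (by simp)).trans_eq hv
  | i :: l, h, v, hl, ⟨g, hg, hg'⟩, hQ => by
    rw [List.nodup_cons] at hl
    refine ge_of_tendsto hg' ?_
    filter_upwards [hg, eventually_one_div_add_one_le hδ] with n hn hnδ
    refine hn.nonneg hδ hl.2 fun h' h1 h2 => hQ h' ?_ ?_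
    · refine List.forall_mem_cons.2 ⟨?_, h1⟩
      rw [h2 i hl.1, Function.update_self]
      exact ⟨by positivity, hnδ⟩
    · intro j hj
      simp only [List.mem_cons, not_or] at hj
      rw [h2 j hj.2, Function.update_of_ne hj.1]

theorem iterLiminf_congr {Q R : (Fin d → ℝ) → ENNReal} {l : List (Fin d)} (hl : l.Nodup)
    {h : Fin d → ℝ}
    (hQ : ∀ h', (∀ j ∈ l, 0 < h' j) → (∀ j, j ∉ l → h' j = h j) → Q h' = R h') :
    iterLiminf Q l h = iterLiminf R l h := by
  induction l generalizing h with
  | nil => exact hQ h (by simp) (by simp)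
  | cons i l ih =>
    rw [List.nodup_cons] at hl
    simp only [iterLiminf]
    congr 1
    funext n
    refine ih hl.2 fun h' h1 h2 => hQ h' ?_ ?_
    · refine List.forall_mem_cons.2 ⟨?_, h1⟩
      rw [h2 i hl.1, Function.update_self]
      positivity
    · intro j hj
      simp only [List.mem_cons, not_or] at hj
      rw [h2 j hj.2, Function.update_of_ne hj.1]

theorem measurable_iterLiminf {α : Type*} [MeasurableSpace α] {Q : (Fin d → ℝ) → α → ENNReal}
    (hQ : ∀ h, Measurable (Q h)) (l : List (Fin d)) (h : Fin d → ℝ) :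
    Measurable fun x => iterLiminf (fun h => Q h x) l h := by
  induction l generalizing h with
  | nil => exact hQ h
  | cons i l ih => exact Measurable.liminf fun n => ih _

/-- Fatou's lemma, once per coordinate. It is the reason for taking limits along the sequence `1 /
(n + 1)`. -/
theorem lintegral_iterLiminf_le {α : Type*} [MeasurableSpace α] {ν : Measure α}
    {Q : (Fin d → ℝ) → α → ENNReal} (hQ : ∀ h, Measurable (Q h)) {c : ENNReal} {δ : ℝ}
    (hδ : 0 < δ) {l : List (Fin d)} (hl : l.Nodup) {h : Fin d → ℝ}
    (hc : ∀ h', (∀ j ∈ l, 0 < h' j ∧ h' j ≤ δ) → (∀ j, j ∉ l → h' j = h j) →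
      ∫⁻ x, Q h' x ∂ν ≤ c) :
    ∫⁻ x, iterLiminf (fun h => Q h x) l h ∂ν ≤ c := by
  induction l generalizing h with
  | nil => exact hc h (by simp) (by simp)
  | cons i l ih =>
    rw [List.nodup_cons] at hl
    refine (lintegral_liminf_le fun n => measurable_iterLiminf hQ l _).trans ?_
    refine liminf_le_of_frequently_le' (Eventually.frequently ?_)
    filter_upwards [eventually_one_div_add_one_le hδ] with n hnδ
    refine ih hl.2 fun h' h1 h2 => hc h' ?_ ?_
    · refine List.forall_mem_cons.2 ⟨?_, h1⟩
      rw [h2 i hl.1, Function.update_self]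
      exact ⟨by positivity, hnδ⟩
    · intro j hj
      simp only [List.mem_cons, not_or] at hj
      rw [h2 j hj.2, Function.update_of_ne hj.1]

/-- Each derivative is the limit of its difference quotients; nesting these in the order of
differentiation yields box differences divided by volumes, with no interchange of limits. -/
theorem HasMixedPartial.hasIterLim {f : (Fin d → ℝ) → ℝ} : ∀ {l : List (Fin d)}
    {x : Fin d → ℝ} {v : ℝ}, l.Nodup → HasMixedPartial f l x v → ∀ h : Fin d → ℝ,
      HasIterLim (fun h => (l.map h).prod⁻¹ * boxDiff x (x + h) f l x) l h v
  | [], _, _, _, hv, _ => by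
    simp only [HasIterLim, boxDiff, List.map_nil, List.prod_nil, inv_one, one_mul]
    exact hv
  | i :: l, x, v, hl, ⟨g, hg, hg'⟩, h => by
    rw [List.nodup_cons] at hl
    have hs : Tendsto (fun n : ℕ => 1 / ((n : ℝ) + 1)) atTop (𝓝[≠] 0) :=
      tendsto_nhdsWithin_iff.2 ⟨tendsto_one_div_add_atTop_nhds_zero_nat,
        .of_forall fun n => (by positivity : (1 : ℝ) / ((n : ℝ) + 1) ≠ 0)⟩
    refine ⟨fun n => (1 / ((n : ℝ) + 1))⁻¹ * (g (x i + 1 / ((n : ℝ) + 1)) - g (x i)), ?_,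
      (hasDerivAt_iff_tendsto_slope_zero.1 hg').comp hs⟩
    have hx : Tendsto (fun n : ℕ => x i + 1 / ((n : ℝ) + 1)) atTop (𝓝 (x i)) := by
      simpa using (tendsto_one_div_add_atTop_nhds_zero_nat (𝕜 := ℝ)).const_add (x i)
    have h0 := hg.self_of_nhds
    rw [Function.update_eq_self] at h0
    filter_upwards [hx.eventually hg] with n hn
    set s : ℝ := 1 / ((n : ℝ) + 1)
    refine (((hn.hasIterLim hl.2 (Function.update h i s)).sub
      (h0.hasIterLim hl.2 (Function.update h i s))).const_mul s⁻¹).congr fun h' hh' => ?_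
    have hi : h' i = s := by simpa using hh' i hl.1
    have hne : ∀ j ∈ l, j ≠ i := fun j hj hji => hl.1 (hji ▸ hj)
    simp only [List.map_cons, List.prod_cons, boxDiff, Pi.add_apply, hi,
      Function.update_eq_self, mul_inv]
    -- The corners may be changed in coordinate `i`, since only the coordinates in `l` are
    -- differenced.
    rw [boxDiff_congr (a := Function.update x i (x i + s)) (a' := x) (b' := x + h')]
    · ring
    · intro j hj; simp [hne j hj]
    · intro j hj; simp [hne j hj]

end MixedPartial

/-! ### Faà di Bruno's formula for iterated partial derivatives. -/

section FaaDiBruno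

/-- The set partitions obtained from `π` by adding `i` to one of its blocks. -/
def insertIntoBlocks {α : Type*} (i : α) : List (List α) → List (List (List α))
  | [] => []
  | B :: π => ((i :: B) :: π) :: (insertIntoBlocks i π).map (B :: ·)

/-- The set partitions of a list. -/
def blockPartitions {α : Type*} : List α → List (List (List α))
  | [] => [[]]
  | i :: l => (blockPartitions l).flatMap fun π => ([i] :: π) :: insertIntoBlocks i π

theorem length_of_mem_insertIntoBlocks {α : Type*} {i : α} {π ρ : List (List α)}
    (h : ρ ∈ insertIntoBlocks i π) : ρ.length = π.length := by
  induction π generalizing ρ with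
  | nil => simp [insertIntoBlocks] at h
  | cons B π ih =>
    simp only [insertIntoBlocks, List.mem_cons, List.mem_map] at h
    obtain rfl | ⟨σ, hσ, rfl⟩ := h
    · simp
    · simp [ih hσ]

theorem sublist_of_mem_insertIntoBlocks {α : Type*} {i : α} {l : List α} {π ρ : List (List α)}
    (h : ρ ∈ insertIntoBlocks i π) (hπ : ∀ B ∈ π, B.Sublist l) : ∀ B ∈ ρ, B.Sublist (i :: l) := by
  induction π generalizing ρ with
  | nil => simp [insertIntoBlocks] at h
  | cons B π ih =>
    simp only [List.forall_mem_cons] at hπ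
    simp only [insertIntoBlocks, List.mem_cons, List.mem_map] at h
    obtain rfl | ⟨σ, hσ, rfl⟩ := h
    · exact List.forall_mem_cons.2 ⟨hπ.1.cons_cons i, fun A hA => (hπ.2 A hA).cons i⟩
    · exact List.forall_mem_cons.2 ⟨hπ.1.cons i, ih hσ hπ.2⟩

theorem sublist_of_mem_blockPartitions {α : Type*} {l : List α} {π : List (List α)}
    (h : π ∈ blockPartitions l) : ∀ B ∈ π, B.Sublist l := by
  induction l generalizing π with
  | nil =>
    simp only [blockPartitions, List.mem_singleton] at h
    simp [h]
  | cons i l ih =>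
    simp only [blockPartitions, List.mem_flatMap, List.mem_cons] at h
    obtain ⟨σ, hσ, rfl | h⟩ := h
    · exact List.forall_mem_cons.2 ⟨by simp, fun A hA => (ih hσ A hA).cons i⟩
    · exact sublist_of_mem_insertIntoBlocks h (ih hσ)

theorem hasDerivAt_list_sum {ι : Type*} (l : List ι) {F : ι → ℝ → ℝ} {F' : ι → ℝ} {t : ℝ}
    (h : ∀ i ∈ l, HasDerivAt (F i) (F' i) t) :
    HasDerivAt (fun s => (l.map fun i => F i s).sum) (l.map F').sum t := by
  induction l with
  | nil => simpa using hasDerivAt_const t (0 : ℝ)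
  | cons i l ih =>
    rw [List.forall_mem_cons] at h
    simp only [List.map_cons, List.sum_cons]
    exact h.1.add (ih h.2)

theorem hasDerivAt_prod_blocks {α : Type*} {i : α} {D : List α → ℝ → ℝ} {D₀ : List α → ℝ} {t : ℝ}
    (hD₀ : ∀ B, D B t = D₀ B) {π : List (List α)}
    (h : ∀ B ∈ π, HasDerivAt (D B) (D₀ (i :: B)) t) :
    HasDerivAt (fun s => (π.map fun B => D B s).prod)
      ((insertIntoBlocks i π).map fun ρ => (ρ.map D₀).prod).sum t := by
  induction π with
  | nil => simpa [insertIntoBlocks] using hasDerivAt_const t (1 : ℝ)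
  | cons B π ih =>
    rw [List.forall_mem_cons] at h
    simp only [List.map_cons, List.prod_cons, insertIntoBlocks, List.sum_cons, List.map_map]
    refine (h.1.mul (ih h.2)).congr_deriv ?_
    simp only [hD₀, Function.comp_def, List.map_cons, List.prod_cons, List.sum_map_mul_left]

variable {d : ℕ}

/-- The iterated partial derivative along `l` of `H 0 ∘ f`, where `H k` is the `k`-th derivative
of `H 0`, according to Faà di Bruno's formula. -/
noncomputable def faaDiBrunoSum (H : ℕ → ℝ) (D : List (Fin d) → ℝ) (l : List (Fin d)) : ℝ :=
  ((blockPartitions l).map fun π => H π.length * (π.map D).prod).sum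

/-- Differentiating a term in `i` either hits the outer function, which creates the block `[i]`, or
one of the factors, which adds `i` to its block. New indices go in front, so blocks stay sublists of
`l` and symmetry of mixed partials is never needed. -/
theorem hasMixedPartial_comp {H : ℕ → ℝ → ℝ} (hH : ∀ k s, HasDerivAt (H k) (H (k + 1) s) s)
    {f : (Fin d → ℝ) → ℝ} {l : List (Fin d)} {x : Fin d → ℝ}
    (hf : ∀ B : List (Fin d), B.Sublist l → ∃ v, HasMixedPartial f B x v) :
    HasMixedPartial (fun y => H 0 (f y)) l x
      (faaDiBrunoSum (fun k => H k (f x)) (fun B => mixedPartial f B x) l) := by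
  induction l generalizing x with
  | nil => simp [HasMixedPartial, faaDiBrunoSum, blockPartitions]
  | cons i l ih =>
    refine ⟨fun t => faaDiBrunoSum (fun k => H k (f (Function.update x i t)))
      (fun B => mixedPartial f B (Function.update x i t)) l, ?_, ?_⟩
    · have h : ∀ᶠ t in 𝓝 (x i), ∀ B ∈ {B : List (Fin d) | B ∈ l.sublists},
          ∃ v, HasMixedPartial f B (Function.update x i t) v := by
        refine (eventually_all_finite l.sublists.finite_toSet).2 fun B hB => ?_
        obtain ⟨v, g, hg, -⟩ := hf (i :: B) ((List.mem_sublists.1 hB).cons_cons i)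
        filter_upwards [hg] with t ht using ⟨_, ht⟩
      filter_upwards [h] with t ht
      exact ih fun B hB => ht B (List.mem_sublists.2 hB)
    · have hD : ∀ B : List (Fin d), B.Sublist l →
          HasDerivAt (fun t => mixedPartial f B (Function.update x i t))
            (mixedPartial f (i :: B) x) (x i) := fun B hB =>
        (hasMixedPartial_mixedPartial (hf (i :: B) (hB.cons_cons i))).hasDerivAt_mixedPartial
      have hf' : HasDerivAt (fun t => f (Function.update x i t)) (mixedPartial f [i] x) (x i) := by
        simpa using hD [] (List.nil_sublist l)
      have hterm : ∀ π ∈ blockPartitions l, HasDerivAt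
          (fun t => H π.length (f (Function.update x i t)) *
            (π.map fun B => mixedPartial f B (Function.update x i t)).prod)
          (((([i] :: π) :: insertIntoBlocks i π).map fun ρ => H ρ.length (f x) *
            (ρ.map fun B => mixedPartial f B x).prod).sum) (x i) := by
        intro π hπ
        have h1 := (hH π.length (f (Function.update x i (x i)))).comp (x i) hf'
        have h2 := hasDerivAt_prod_blocks (i := i) (π := π)
          (D := fun B t => mixedPartial f B (Function.update x i t))
          (D₀ := fun B => mixedPartial f B x) (t := x i) (by simp)
          (fun B hB => hD B (sublist_of_mem_blockPartitions hπ B hB))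
        refine (h1.mul h2).congr_deriv ?_
        simp only [Function.comp_apply, Function.update_eq_self, List.map_cons, List.sum_cons,
          List.length_cons, List.prod_cons, mul_assoc]
        congr 1
        rw [← List.sum_map_mul_left]
        congr 1
        refine List.map_congr_left fun ρ hρ => ?_
        rw [length_of_mem_insertIntoBlocks hρ]
      refine (hasDerivAt_list_sum _ hterm).congr_deriv ?_
      simp only [faaDiBrunoSum, blockPartitions, List.map_flatMap]
      simp only [List.flatMap, List.sum_flatten, List.map_map, Function.comp_def]

theorem tendsto_faaDiBrunoSum {κ : Type*} {F : Filter κ} {H : κ → ℕ → ℝ} {H₀ : ℕ → ℝ}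
    (hH : ∀ k, Tendsto (fun n => H n k) F (𝓝 (H₀ k))) {D : κ → List (Fin d) → ℝ}
    {D₀ : List (Fin d) → ℝ} {l : List (Fin d)}
    (hD : ∀ B : List (Fin d), B.Sublist l → Tendsto (fun n => D n B) F (𝓝 (D₀ B))) :
    Tendsto (fun n => faaDiBrunoSum (H n) (D n) l) F (𝓝 (faaDiBrunoSum H₀ D₀ l)) :=
  tendsto_list_sum _ fun _ hπ => (hH _).mul <| tendsto_list_prod _ fun B hB =>
    hD B (sublist_of_mem_blockPartitions hπ B hB)

end FaaDiBruno

/-! ### Lower densities as subdensities. -/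

section LowerDensity

variable {d : ℕ}

/-- The half-open box with lower corner `x` and side lengths `h`. -/
def cornerBox (x h : Fin d → ℝ) : Set (Fin d → ℝ) :=
  Set.univ.pi fun j => Set.Ioc (x j) (x j + h j)

theorem measurableSet_cornerBox_prod (h : Fin d → ℝ) :
    MeasurableSet {p : (Fin d → ℝ) × (Fin d → ℝ) | p.2 ∈ cornerBox p.1 h} := by
  simp only [cornerBox, Set.mem_pi, Set.mem_univ, true_imp_iff, Set.mem_Ioc, Set.ofPred_forall,
    Set.ofPred_and]
  refine MeasurableSet.iInter fun j => ?_
  have h1 : Measurable fun p : (Fin d → ℝ) × (Fin d → ℝ) => p.1 j :=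
    (measurable_pi_apply j).comp measurable_fst
  have h2 : Measurable fun p : (Fin d → ℝ) × (Fin d → ℝ) => p.2 j :=
    (measurable_pi_apply j).comp measurable_snd
  exact (measurableSet_lt h1 h2).inter (measurableSet_le h2 (h1.add_const _))

/-- The mean density of `μ` over a half-open box. -/
noncomputable def meanDensity (μ : Measure (Fin d → ℝ)) (h x : Fin d → ℝ) : ENNReal :=
  ENNReal.ofReal (∏ j, h j)⁻¹ * μ (cornerBox x h)

theorem measurable_meanDensity (μ : Measure (Fin d → ℝ)) [SFinite μ] (h : Fin d → ℝ) :
    Measurable (meanDensity μ h) :=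
  (measurable_measure_prodMk_left (ν := μ) (measurableSet_cornerBox_prod h)).const_mul _

/-- By Tonelli: for fixed `y`, the `x` whose box contains `y` fill a box of volume `∏ j, h j`, and
such an `x` in `K` lies within `δ` of `y`. -/
theorem lintegral_meanDensity_le (μ : Measure (Fin d → ℝ)) [SFinite μ] {K : Set (Fin d → ℝ)}
    (hK : MeasurableSet K) {δ : ℝ} (hδ : 0 ≤ δ) {h : Fin d → ℝ} (h0 : ∀ j, 0 < h j)
    (hhδ : ∀ j, h j ≤ δ) :
    ∫⁻ x in K, meanDensity μ h x ≤ μ (Metric.cthickening δ K) := by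
  have hp : 0 < ∏ j, h j := Finset.prod_pos fun j _ => h0 j
  set S := {p : (Fin d → ℝ) × (Fin d → ℝ) | p.2 ∈ cornerBox p.1 h} with hS
  have hSm : MeasurableSet S := measurableSet_cornerBox_prod h
  have h1 : ∫⁻ x in K, μ (cornerBox x h) ≤
      ENNReal.ofReal (∏ j, h j) * μ (Metric.cthickening δ K) := by
    calc ∫⁻ x in K, μ (cornerBox x h) = ((volume.restrict K).prod μ) S :=
          (Measure.prod_apply hSm).symm
      _ = ∫⁻ y, volume.restrict K ((fun x => (x, y)) ⁻¹' S) ∂μ := Measure.prod_apply_symm hSm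
      _ ≤ ∫⁻ y, (Metric.cthickening δ K).indicator
            (fun _ => ENNReal.ofReal (∏ j, h j)) y ∂μ := by
          refine lintegral_mono fun y => ?_
          by_cases hy : y ∈ Metric.cthickening δ K
          · rw [Set.indicator_of_mem hy]
            refine (Measure.restrict_apply_le _ _).trans ?_
            have hsub : (fun x => (x, y)) ⁻¹' S ⊆
                Set.univ.pi fun j => Set.Ico (y j - h j) (y j) := by
              intro x hx j _
              have := hx j (Set.mem_univ j)
              exact ⟨by linarith [this.2], this.1⟩
            refine (measure_mono hsub).trans_eq ?_
            rw [Real.volume_pi_Ico, ENNReal.ofReal_prod_of_nonneg fun j _ => (h0 j).le]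
            simp
          · rw [Set.indicator_of_notMem hy, nonpos_iff_eq_zero,
              Measure.restrict_apply' hK]
            convert measure_empty (μ := volume)
            refine Set.eq_empty_of_forall_notMem fun x ⟨hx, hxK⟩ => hy ?_
            refine Metric.mem_cthickening_of_dist_le y x δ K hxK ?_
            refine (dist_pi_le_iff hδ).2 fun j => ?_
            have := hx j (Set.mem_univ j)
            rw [Real.dist_eq, abs_of_nonneg (by linarith [this.1])]
            linarith [this.2, hhδ j]
      _ = _ := lintegral_indicator_const Metric.isClosed_cthickening.measurableSet _
  simp only [meanDensity]
  rw [lintegral_const_mul]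
  · refine (mul_le_mul_right h1 _).trans_eq ?_
    rw [← mul_assoc, ← ENNReal.ofReal_mul (by positivity), inv_mul_cancel₀ hp.ne',
      ENNReal.ofReal_one, one_mul]
  · exact measurable_measure_prodMk_left (ν := μ) hSm

/-- The iterated lower density of `μ`. -/
noncomputable def lowerDensity (μ : Measure (Fin d → ℝ)) (x : Fin d → ℝ) : ENNReal :=
  iterLiminf (fun h => meanDensity μ h x) (List.finRange d) 1

theorem measurable_lowerDensity (μ : Measure (Fin d → ℝ)) [SFinite μ] :
    Measurable (lowerDensity μ) :=
  measurable_iterLiminf (measurable_meanDensity μ) _ _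

theorem setLIntegral_lowerDensity_le_of_isCompact (μ : Measure (Fin d → ℝ)) [IsFiniteMeasure μ]
    {K : Set (Fin d → ℝ)} (hK : IsCompact K) : ∫⁻ x in K, lowerDensity μ x ≤ μ K := by
  have h1 (δ : ℝ) (hδ : 0 < δ) : ∫⁻ x in K, lowerDensity μ x ≤ μ (Metric.cthickening δ K) :=
    lintegral_iterLiminf_le (measurable_meanDensity μ) hδ (List.nodup_finRange d)
      fun h' hh' _ => lintegral_meanDensity_le μ hK.measurableSet hδ.le
        (fun j => (hh' j (List.mem_finRange j)).1) (fun j => (hh' j (List.mem_finRange j)).2)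
  have h2 : Tendsto (fun δ => μ (Metric.cthickening δ K)) (𝓝[>] 0) (𝓝 (μ K)) :=
    (tendsto_measure_cthickening_of_isCompact hK).mono_left nhdsWithin_le_nhds
  exact ge_of_tendsto h2 (by filter_upwards [self_mem_nhdsWithin] with δ hδ using h1 δ hδ)

theorem setLIntegral_lowerDensity_le (μ : Measure (Fin d → ℝ)) [IsFiniteMeasure μ]
    {A : Set (Fin d → ℝ)} (hA : MeasurableSet A) : ∫⁻ x in A, lowerDensity μ x ≤ μ A := by
  set ν := (volume : Measure (Fin d → ℝ)).withDensity (lowerDensity μ)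
  have hν (K : Set (Fin d → ℝ)) (hK : IsCompact K) : ν K ≤ μ K := by
    rw [withDensity_apply _ hK.measurableSet]
    exact setLIntegral_lowerDensity_le_of_isCompact μ hK
  -- Finiteness on compacts makes `ν` inner regular, so the bound passes from compact to Borel sets.
  have : IsFiniteMeasureOnCompacts ν := ⟨fun K hK => (hν K hK).trans_lt (measure_lt_top μ K)⟩
  rw [← withDensity_apply _ hA]
  change ν A ≤ μ A
  rw [hA.measure_eq_iSup_isCompact ν]
  exact iSup₂_le fun K hKA => iSup_le fun hK => (hν K hK).trans (measure_mono hKA)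

theorem lowerDensity_eq_of_hasMixedPartial (μ : Measure (Fin d → ℝ)) [IsFiniteMeasure μ]
    {x : Fin d → ℝ} {v : ℝ}
    (hv : HasMixedPartial (fun y => μ.real (Set.Iic y)) (List.finRange d) x v) :
    lowerDensity μ x = ENNReal.ofReal v := by
  rw [← (hv.hasIterLim (List.nodup_finRange d) 1).iterLiminf_eq, lowerDensity]
  refine iterLiminf_congr (List.nodup_finRange d) fun h hpos _ => ?_
  have h0 : ∀ j, 0 < h j := fun j => hpos j (List.mem_finRange j)
  have hp : 0 < ∏ j, h j := Finset.prod_pos fun j _ => h0 j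
  rw [boxDiff_measureReal μ (b := x + h) (fun j => (lt_add_of_pos_right (x j) (h0 j)).le)
    (List.nodup_finRange d), ← Fin.prod_univ_def, ENNReal.ofReal_mul (by positivity),
    ofReal_measureReal, meanDensity]
  congr 2
  ext y
  simp [cornerBox]

end LowerDensity

/-! ### Integrating a mixed partial over a box. -/

section IteratedFTC

variable {d : ℕ}

/-- A nonnegative derivative is automatically integrable, so continuity of `g'` is not needed. -/
theorem lintegral_Ioc_ofReal_deriv {a b : ℝ} (hab : a ≤ b) {g g' : ℝ → ℝ}
    (hg : ∀ t ∈ Set.Icc a b, HasDerivAt g (g' t) t) (hg' : ∀ t ∈ Set.Icc a b, 0 ≤ g' t) :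
    ∫⁻ t in Set.Ioc a b, ENNReal.ofReal (g' t) = ENNReal.ofReal (g b - g a) := by
  have hc : ContinuousOn g (Set.Icc a b) := fun t ht => (hg t ht).continuousAt.continuousWithinAt
  have hi : IntegrableOn g' (Set.Ioc a b) :=
    intervalIntegral.integrableOn_deriv_of_nonneg hc
      (fun t ht => hg t (Set.Ioo_subset_Icc_self ht)) fun t ht => hg' t (Set.Ioo_subset_Icc_self ht)
  have hii : IntervalIntegrable g' volume a b :=
    (intervalIntegrable_iff_integrableOn_Ioc_of_le hab).2 hi
  rw [← intervalIntegral.integral_eq_sub_of_hasDerivAt_of_le hab hc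
    (fun t ht => hg t (Set.Ioo_subset_Icc_self ht)) hii, intervalIntegral.integral_of_le hab,
    ofReal_integral_eq_lintegral_ofReal hi]
  exact (ae_restrict_iff' measurableSet_Ioc).2
    (.of_forall fun t ht => hg' t (Set.Ioc_subset_Icc_self ht))

theorem lmarginal_eq_zero_of_notMem {S : Set (Fin d → ℝ)} {g : (Fin d → ℝ) → ENNReal}
    {s : Finset (Fin d)} {k : Fin d} (hk : k ∉ s) {x : Fin d → ℝ}
    (hS : ∀ y ∈ S, y k ≠ x k) :
    lmarginal (fun _ => volume) s (S.indicator g) x = 0 := by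
  rw [lmarginal, lintegral_eq_zero_of_ae_eq_zero]
  refine .of_forall fun y => Set.indicator_of_notMem (fun hy => hS _ hy ?_) _
  simp [Function.updateFinset, hk]

/-- Integration over the variables in `p` undoes the outermost derivatives, starting with the very
last one taken; what remains is a box difference in `p` of the inner partial along `l`. -/
theorem lmarginal_mixedPartial {f : (Fin d → ℝ) → ℝ} {full : List (Fin d)} (hfull : full.Nodup)
    (hf : ∀ l, l <:+ full → ∀ x : Fin d → ℝ, (∀ j, x j < 0) → ∃ v, HasMixedPartial f l x v)
    {a b : Fin d → ℝ} (hab : a ≤ b) (hb : ∀ j, b j < 0)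
    (hbox : ∀ (a' b' : Fin d → ℝ) (l : List (Fin d)) (x : Fin d → ℝ), l.Nodup → a' ≤ b' →
      b' ≤ 0 → x ≤ 0 → 0 ≤ boxDiff a' b' f l x)
    {g : (Fin d → ℝ) → ENNReal}
    (hgm : Measurable ((Set.univ.pi fun j => Set.Ioc (a j) (b j)).indicator g))
    (hg : ∀ x, (∀ j, x j < 0) → g x = ENNReal.ofReal (mixedPartial f full x))
    (p : List (Fin d)) : ∀ l, full = p.reverse ++ l → ∀ x : Fin d → ℝ,
      (∀ j, x j < 0) → (∀ j, j ∉ p → x j ∈ Set.Ioc (a j) (b j)) →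
      lmarginal (fun _ => volume) p.toFinset
          ((Set.univ.pi fun j => Set.Ioc (a j) (b j)).indicator g) x =
        ENNReal.ofReal (boxDiff a b (mixedPartial f l) p x) := by
  have ha : ∀ j, a j < 0 := fun j => (hab j).trans_lt (hb j)
  induction p with
  | nil =>
    rintro l rfl x hx hxb
    rw [List.toFinset_nil, lmarginal_empty, Set.indicator_of_mem, hg x hx]
    · rfl
    · exact fun j _ => hxb j (by simp)
  | cons k p ih =>
    intro l hl x hx hxb
    have hl' : full = p.reverse ++ (k :: l) := by simp [hl]
    have hnd := hfull
    rw [hl', List.nodup_append'] at hnd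
    obtain ⟨hpn, hkl, hdisj⟩ := hnd
    have hkp : k ∉ p := fun h => hdisj (List.mem_reverse.2 h) (List.mem_cons_self)
    have hupd (t : ℝ) (ht : t < 0) : ∀ j, Function.update x k t j < 0 := fun j => by
      by_cases hj : j = k
      · subst hj; simpa
      · simpa [hj] using hx j
    have hD (l' : List (Fin d)) (h : l' <:+ full) (y : Fin d → ℝ) (hy : ∀ j, y j < 0) :
        HasMixedPartial f l' y (mixedPartial f l' y) :=
      hasMixedPartial_mixedPartial (hf l' h y hy)
    have hsuf : (k :: l) <:+ full := ⟨p.reverse, hl'.symm⟩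
    have hderiv (t : ℝ) (ht : t < 0) :
        HasDerivAt (fun s => boxDiff a b (mixedPartial f l) p (Function.update x k s))
          (boxDiff a b (mixedPartial f (k :: l)) p (Function.update x k t)) t := by
      have := hasDerivAt_boxDiff (g := mixedPartial f l) (g' := mixedPartial f (k :: l)) ha hb
        (k := k) (fun y hy => (hD _ hsuf y hy).hasDerivAt_mixedPartial) hkp (hupd t ht)
      simpa using this
    -- The integrand is an iterated limit of quotients of box differences of `f`, which are
    -- nonnegative by `hbox`.
    have hnonneg (t : ℝ) (ht : t < 0) :
        0 ≤ boxDiff a b (mixedPartial f (k :: l)) p (Function.update x k t) := by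
      have h1 := hasMixedPartial_boxDiff ha hb (hD _ hsuf)
        (p := p) (fun j hj hj' => hdisj (List.mem_reverse.2 hj') hj) (hupd t ht)
      set y := Function.update x k t
      have hy := hupd t ht
      obtain ⟨δ, hδ, hyδ⟩ : ∃ δ > 0, ∀ j, y j + δ ≤ 0 := by
        have : ∀ᶠ δ in 𝓝[>] (0 : ℝ), ∀ j, δ < -y j := eventually_all.2 fun j =>
          eventually_nhdsWithin_of_eventually_nhds (eventually_lt_nhds (by linarith [hy j]))
        obtain ⟨δ, h, h'⟩ := (this.and self_mem_nhdsWithin).exists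
        exact ⟨δ, h', fun j => by linarith [h j]⟩
      refine (h1.hasIterLim hkl y).nonneg hδ hkl fun h' hh' _ => mul_nonneg
        (inv_nonneg.2 (List.prod_nonneg ?_)) ?_
      · simp only [List.mem_map]
        rintro _ ⟨j, hj, rfl⟩
        exact (hh' j hj).1.le
      -- The differences along `p` and along `k :: l` use different corners; common corners merge
      -- them into one box difference.
      · have e1 : boxDiff a b f p = boxDiff (fun j => if j ∈ p then a j else y j)
            (fun j => if j ∈ p then b j else if j ∈ k :: l then y j + h' j else y j) f p := by
          funext z
          exact boxDiff_congr f (fun j hj => by simp [hj]) (fun j hj => by simp [hj]) z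
        have hnp : ∀ j ∈ k :: l, j ∉ p := fun j hj hj' => hdisj (List.mem_reverse.2 hj') hj
        rw [boxDiff_congr (a' := fun j => if j ∈ p then a j else y j)
          (b' := fun j => if j ∈ p then b j else if j ∈ k :: l then y j + h' j else y j) _
          (fun j hj => by simp [hnp j hj]) (fun j hj => by simp only [hnp j hj, hj]; simp), e1,
          ← boxDiff_append]
        refine hbox _ _ _ _ ?_ ?_ ?_ fun j => (hy j).le
        · exact List.nodup_append'.2 ⟨hkl, List.nodup_reverse.1 hpn, fun j hj => hnp j hj⟩
        · intro j
          dsimp only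
          split_ifs with h1 h2
          · exact hab j
          · linarith [(hh' j h2).1]
          · exact le_rfl
        · intro j
          dsimp only
          split_ifs with h1 h2
          · exact (hb j).le
          · exact (add_le_add_right (hh' j h2).2 _).trans (hyδ j)
          · exact (hy j).le
    have hks : k ∉ p.toFinset := by simpa using hkp
    rw [List.toFinset_cons, lmarginal_insert _ hgm hks, boxDiff,
      ← lintegral_Ioc_ofReal_deriv (hab k) (fun t ht => hderiv t (ht.2.trans_lt (hb k)))
        (fun t ht => hnonneg t (ht.2.trans_lt (hb k))), ← lintegral_indicator measurableSet_Ioc]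
    refine lintegral_congr fun t => ?_
    by_cases ht : t ∈ Set.Ioc (a k) (b k)
    · rw [Set.indicator_of_mem ht]
      refine ih (k :: l) hl' _ (hupd t (ht.2.trans_lt (hb k))) fun j hj => ?_
      by_cases hjk : j = k
      · subst hjk; simpa using ht
      · simpa [hjk] using hxb j (by simp [hjk, hj])
    · rw [Set.indicator_of_notMem ht]
      refine lmarginal_eq_zero_of_notMem hks fun y hy hyk => ht ?_
      have := hy k (Set.mem_univ k)
      rwa [hyk, Function.update_self] at this

theorem setLIntegral_mixedPartial {f : (Fin d → ℝ) → ℝ}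
    (hf : ∀ l, l <:+ List.finRange d → ∀ x : Fin d → ℝ, (∀ j, x j < 0) →
      ∃ v, HasMixedPartial f l x v)
    {a b : Fin d → ℝ} (hab : a ≤ b) (hb : ∀ j, b j < 0)
    (hbox : ∀ (a' b' : Fin d → ℝ) (l : List (Fin d)) (x : Fin d → ℝ), l.Nodup → a' ≤ b' →
      b' ≤ 0 → x ≤ 0 → 0 ≤ boxDiff a' b' f l x)
    {g : (Fin d → ℝ) → ENNReal} (hgm : Measurable g)
    (hg : ∀ x, (∀ j, x j < 0) → g x = ENNReal.ofReal (mixedPartial f (List.finRange d) x)) :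
    ∫⁻ x in Set.univ.pi fun j => Set.Ioc (a j) (b j), g x =
      ENNReal.ofReal (boxDiff a b f (List.finRange d).reverse b) := by
  have hm : MeasurableSet (Set.univ.pi fun j => Set.Ioc (a j) (b j)) :=
    MeasurableSet.univ_pi fun j => measurableSet_Ioc
  have h := lmarginal_mixedPartial (List.nodup_finRange d) hf hab hb hbox (hgm.indicator hm) hg
    (List.finRange d).reverse [] (by simp) b hb (by simp)
  have h0 : mixedPartial f [] = f := funext fun y => mixedPartial_nil f y
  have hu : (List.finRange d).reverse.toFinset = Finset.univ := by ext; simp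
  rw [h0, hu] at h
  rwa [← lintegral_indicator hm, volume_pi, lintegral_eq_lmarginal_univ b]

end IteratedFTC

/-! ### The limit law and Scheffé's argument. -/

section Scheffe

variable {d : ℕ}

/-- Every corner of the box other than `b` has some coordinate equal to that of `a`. -/
theorem abs_boxDiff_sub_le {a b : Fin d → ℝ} {f : (Fin d → ℝ) → ℝ} {c : ℝ} (hc : 0 ≤ c)
    {l : List (Fin d)} (hl : l.Nodup) (hf : ∀ z ≤ 0, ∀ i, z i = a i → |f z| ≤ c) (ha : a ≤ 0)
    (hb : b ≤ 0) : |boxDiff a b f l b - f b| ≤ 2 ^ l.length * c := by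
  induction l with
  | nil => simpa [boxDiff] using hc
  | cons i l ih =>
    rw [List.nodup_cons] at hl
    have h1 := ih hl.2
    have h2 := abs_boxDiff_le (a := a) (b := b) (f := f) (c := c) l hl.1
      (fun z hz hzi => hf z hz i hzi) ha hb (x := Function.update b i (a i))
      (update_le_iff.2 ⟨ha i, fun j _ => hb j⟩) (by simp)
    simp only [boxDiff, Function.update_eq_self, List.length_cons, pow_succ]
    rw [abs_le] at *
    constructor <;> linarith

/-- The open negative orthant. -/
def negOrthant (d : ℕ) : Set (Fin d → ℝ) := Set.univ.pi fun _ => Set.Iio 0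

theorem mem_negOrthant {x : Fin d → ℝ} : x ∈ negOrthant d ↔ ∀ j, x j < 0 := by
  simp [negOrthant]

theorem measurableSet_negOrthant : MeasurableSet (negOrthant d) :=
  MeasurableSet.univ_pi fun _ => measurableSet_Iio

/-- Half-open boxes that exhaust the open orthant below `x`. -/
theorem iUnion_pi_Ioc (x : Fin d → ℝ) :
    ⋃ n : ℕ, (Set.univ.pi fun j => Set.Ioc (x j - ((n : ℝ) + 1)) (x j - 1 / ((n : ℝ) + 1))) =
      Set.univ.pi fun j => Set.Iio (x j) := by
  ext y
  simp only [Set.mem_iUnion, Set.mem_pi, Set.mem_univ, true_imp_iff, Set.mem_Ioc, Set.mem_Iio]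
  constructor
  · rintro ⟨n, hn⟩ j
    have : (0 : ℝ) < 1 / ((n : ℝ) + 1) := by positivity
    linarith [(hn j).2]
  · intro h
    have h1 : ∀ᶠ n : ℕ in atTop, ∀ j, x j - ((n : ℝ) + 1) < y j := eventually_all.2 fun j => by
      filter_upwards [tendsto_natCast_atTop_atTop.eventually_gt_atTop (x j - y j)] with n hn
      linarith
    have h2 : ∀ᶠ n : ℕ in atTop, ∀ j, y j ≤ x j - 1 / ((n : ℝ) + 1) := eventually_all.2 fun j => by
      filter_upwards [eventually_one_div_add_one_le (sub_pos.2 (h j))] with n hn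
      linarith
    obtain ⟨n, hn⟩ := (h1.and h2).exists
    exact ⟨n, fun j => ⟨hn.1 j, hn.2 j⟩⟩

theorem monotone_pi_Ioc (x : Fin d → ℝ) : Monotone fun n : ℕ =>
    (Set.univ.pi fun j => Set.Ioc (x j - ((n : ℝ) + 1)) (x j - 1 / ((n : ℝ) + 1))) := by
  intro m n hmn
  have h : (m : ℝ) ≤ n := by exact_mod_cast hmn
  refine Set.pi_mono fun j _ => Set.Ioc_subset_Ioc (by linarith) ?_
  have : 1 / ((n : ℝ) + 1) ≤ 1 / ((m : ℝ) + 1) := by gcongr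
  linarith

/-- The measure on the negative orthant whose density is the lower limit of the lower densities. -/
noncomputable def limitLaw (μ : ℕ → Measure (Fin d → ℝ)) : Measure (Fin d → ℝ) :=
  (volume.restrict (negOrthant d)).withDensity fun x =>
    liminf (fun n => lowerDensity (μ n) x) atTop


/-- The law is carried by the negative orthant, so its total mass is its value on `Set.Iic 0`. -/
theorem isProbabilityMeasure_limitLaw {μ : ℕ → Measure (Fin d → ℝ)} {E : (Fin d → ℝ) → ℝ}
    (hE0 : E 0 = 1)
    (h : limitLaw μ (Set.Iic 0) = ENNReal.ofReal (E 0)) : IsProbabilityMeasure (limitLaw μ) := by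
  refine ⟨?_⟩
  rw [hE0, ENNReal.ofReal_one] at h
  rw [← h, limitLaw, withDensity_apply _ MeasurableSet.univ, withDensity_apply _ measurableSet_Iic,
    Measure.restrict_restrict measurableSet_Iic, Measure.restrict_univ, Set.inter_eq_right.2]
  exact fun x hx j => (mem_negOrthant.1 hx j).le

variable {μ : ℕ → Measure (Fin d → ℝ)} [∀ n, IsProbabilityMeasure (μ n)] {E : (Fin d → ℝ) → ℝ}

theorem tendsto_lowerDensity
    (hpart : ∀ x : Fin d → ℝ, (∀ j, x j < 0) → ∃ v : ℕ → ℝ,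
      (∀ᶠ n in atTop, HasMixedPartial (fun y => (μ n).real (Set.Iic y)) (List.finRange d) x (v n)) ∧
        Tendsto v atTop (𝓝 (mixedPartial E (List.finRange d) x)))
    {x : Fin d → ℝ} (hx : ∀ j, x j < 0) :
    Tendsto (fun n => lowerDensity (μ n) x) atTop
      (𝓝 (ENNReal.ofReal (mixedPartial E (List.finRange d) x))) := by
  obtain ⟨v, hv, hv'⟩ := hpart x hx
  refine (ENNReal.tendsto_ofReal hv').congr' ?_
  filter_upwards [hv] with n hn
  exact (lowerDensity_eq_of_hasMixedPartial (μ n) hn).symm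

/-- This is why the limit density is defined as a lower limit: on the open orthant it agrees with
the mixed partial of `E`, whose measurability is not otherwise at hand. -/
theorem measurable_liminf_lowerDensity (μ : ℕ → Measure (Fin d → ℝ))
    [∀ n, IsProbabilityMeasure (μ n)] :
    Measurable fun x => liminf (fun n => lowerDensity (μ n) x) atTop :=
  Measurable.liminf fun n => measurable_lowerDensity (μ n)

theorem limitLaw_Ioc
    (hcdf : ∀ x ≤ 0, Tendsto (fun n => (μ n).real (Set.Iic x)) atTop (𝓝 (E x)))
    (hE : ∀ l, l <:+ List.finRange d → ∀ x : Fin d → ℝ, (∀ j, x j < 0) →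
      ∃ v, HasMixedPartial E l x v)
    (hpart : ∀ x : Fin d → ℝ, (∀ j, x j < 0) → ∃ v : ℕ → ℝ,
      (∀ᶠ n in atTop, HasMixedPartial (fun y => (μ n).real (Set.Iic y)) (List.finRange d) x (v n)) ∧
        Tendsto v atTop (𝓝 (mixedPartial E (List.finRange d) x)))
    {a b : Fin d → ℝ} (hab : a ≤ b) (hb : ∀ j, b j < 0) :
    limitLaw μ (Set.univ.pi fun j => Set.Ioc (a j) (b j)) =
      ENNReal.ofReal (boxDiff a b E (List.finRange d).reverse b) := by
  have hm : MeasurableSet (Set.univ.pi fun j => Set.Ioc (a j) (b j)) :=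
    MeasurableSet.univ_pi fun j => measurableSet_Ioc
  rw [limitLaw, withDensity_apply _ hm, Measure.restrict_restrict hm, Set.inter_eq_left.2]
  · refine setLIntegral_mixedPartial hE hab hb ?_ (measurable_liminf_lowerDensity μ)
      fun x hx => (tendsto_lowerDensity hpart hx).liminf_eq
    intro a' b' l x hl hab' hb' hx
    exact ge_of_tendsto' (tendsto_boxDiff hcdf (hab'.trans hb') hb' l hx)
      fun n => boxDiff_measureReal_nonneg (μ n) hab' hl x
  · exact Set.pi_mono fun j _ t ht => ht.2.trans_lt (hb j)

theorem limitLaw_Iic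
    (hcdf : ∀ x ≤ 0, Tendsto (fun n => (μ n).real (Set.Iic x)) atTop (𝓝 (E x)))
    (hE : ∀ l, l <:+ List.finRange d → ∀ x : Fin d → ℝ, (∀ j, x j < 0) →
      ∃ v, HasMixedPartial E l x v)
    (hpart : ∀ x : Fin d → ℝ, (∀ j, x j < 0) → ∃ v : ℕ → ℝ,
      (∀ᶠ n in atTop, HasMixedPartial (fun y => (μ n).real (Set.Iic y)) (List.finRange d) x (v n)) ∧
        Tendsto v atTop (𝓝 (mixedPartial E (List.finRange d) x)))
    (hEc : Continuous E) (hEle : ∀ z ≤ 0, ∀ i, E z ≤ Real.exp (z i))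
    {x : Fin d → ℝ} (hx : x ≤ 0) :
    limitLaw μ (Set.Iic x) = ENNReal.ofReal (E x) := by
  have hac : limitLaw μ ≪ volume :=
    (withDensity_absolutelyContinuous _ _).trans Measure.restrict_le_self.absolutelyContinuous
  rw [← measure_congr (hac.ae_eq
    (Measure.univ_pi_Iio_ae_eq_Iic (μ := fun _ : Fin d => (volume : Measure ℝ)) (f := x))),
    ← iUnion_pi_Ioc]
  refine tendsto_nhds_unique (tendsto_measure_iUnion_atTop (monotone_pi_Ioc x)) ?_
  set a : ℕ → Fin d → ℝ := fun n j => x j - ((n : ℝ) + 1)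
  set b : ℕ → Fin d → ℝ := fun n j => x j - 1 / ((n : ℝ) + 1)
  have hb (n : ℕ) (j : Fin d) : b n j < 0 := by
    have : (0 : ℝ) < 1 / ((n : ℝ) + 1) := by positivity
    have := hx j
    simp only [Pi.zero_apply] at this
    simp only [b]
    linarith
  have hab (n : ℕ) : a n ≤ b n := fun j => by
    have h1 : (0 : ℝ) ≤ n := n.cast_nonneg
    have h2 : 1 / ((n : ℝ) + 1) ≤ 1 := by
      rw [div_le_one (by positivity)]
      linarith
    simp only [a, b]
    linarith
  have hE0 (z : Fin d → ℝ) (hz : z ≤ 0) : 0 ≤ E z :=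
    ge_of_tendsto' (hcdf z hz) fun n => measureReal_nonneg
  have hbx : Tendsto b atTop (𝓝 x) := tendsto_pi_nhds.2 fun j => by
    simpa [b] using (tendsto_one_div_add_atTop_nhds_zero_nat (𝕜 := ℝ)).const_sub (x j)
  -- A coordinate of `a n` is `x i - (n + 1) ≤ -n`, so `E` is at most `exp (-n)` at every corner
  -- other than `b n`.
  have hbound (n : ℕ) : |boxDiff (a n) (b n) E (List.finRange d).reverse (b n) - E (b n)| ≤
      2 ^ (List.finRange d).reverse.length * Real.exp (-(n : ℝ)) := by
    refine abs_boxDiff_sub_le (Real.exp_pos _).le (List.nodup_reverse.2 (List.nodup_finRange d))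
      (fun z hz i hzi => ?_) ((hab n).trans fun j => (hb n j).le) fun j => (hb n j).le
    rw [abs_of_nonneg (hE0 z hz)]
    refine (hEle z hz i).trans (Real.exp_le_exp.2 ?_)
    have := hx i
    simp only [Pi.zero_apply] at this
    rw [hzi]
    simp only [a]
    linarith
  have hlim : Tendsto (fun n => boxDiff (a n) (b n) E (List.finRange d).reverse (b n)) atTop
      (𝓝 (E x)) := by
    have h1 : Tendsto (fun n : ℕ => 2 ^ (List.finRange d).reverse.length * Real.exp (-(n : ℝ)))
        atTop (𝓝 0) := by
      simpa using (Real.tendsto_exp_neg_atTop_nhds_zero.comp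
        tendsto_natCast_atTop_atTop).const_mul ((2 : ℝ) ^ (List.finRange d).reverse.length)
    have h2 := (squeeze_zero_norm hbound h1).add ((hEc.tendsto x).comp hbx)
    simpa [Function.comp_def] using h2
  refine (ENNReal.tendsto_ofReal hlim).congr fun n => ?_
  exact (limitLaw_Ioc hcdf hE hpart (hab n) (hb n)).symm

theorem tendsto_iSup_abs_sub_limitLaw [IsProbabilityMeasure (limitLaw μ)]
    (hpart : ∀ x : Fin d → ℝ, (∀ j, x j < 0) → ∃ v : ℕ → ℝ,
      (∀ᶠ n in atTop, HasMixedPartial (fun y => (μ n).real (Set.Iic y)) (List.finRange d) x (v n)) ∧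
        Tendsto v atTop (𝓝 (mixedPartial E (List.finRange d) x))) :
    Tendsto (fun n => ⨆ A : {A : Set (Fin d → ℝ) // MeasurableSet A},
      |(μ n).real A.1 - (limitLaw μ).real A.1|) atTop (𝓝 0) := by
  set g : (Fin d → ℝ) → ENNReal := fun x => liminf (fun n => lowerDensity (μ n) x) atTop
  have hgm : Measurable g := measurable_liminf_lowerDensity μ
  have hg1 : ∫⁻ x in negOrthant d, g x = 1 := by
    rw [← measure_univ (μ := limitLaw μ), limitLaw, withDensity_apply _ MeasurableSet.univ,
      Measure.restrict_univ]
  -- Truncated subtraction in `ENNReal` is the positive part, dominated by `g`, which has integral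
  -- one.
  have hε : Tendsto (fun n => ∫⁻ x in negOrthant d, (g x - lowerDensity (μ n) x)) atTop
      (𝓝 (∫⁻ x in negOrthant d, 0)) := by
    refine tendsto_lintegral_of_dominated_convergence g
      (fun n => hgm.sub (measurable_lowerDensity (μ n)))
      (fun n => .of_forall fun x => tsub_le_self) (by simp [hg1]) ?_
    refine (ae_restrict_iff' measurableSet_negOrthant).2 (.of_forall fun x hx => ?_)
    have h := tendsto_lowerDensity hpart (mem_negOrthant.1 hx)
    have hgx : g x = ENNReal.ofReal (mixedPartial E (List.finRange d) x) := h.liminf_eq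
    rw [← hgx] at h
    have := ENNReal.Tendsto.sub (tendsto_const_nhds (x := g x)) h
      (Or.inl (by simp [hgx]))
    rwa [tsub_self] at this
  rw [lintegral_zero] at hε
  have hle (n : ℕ) (A : Set (Fin d → ℝ)) (hA : MeasurableSet A) :
      limitLaw μ A ≤ (∫⁻ x in negOrthant d, (g x - lowerDensity (μ n) x)) + μ n A := by
    rw [limitLaw, withDensity_apply _ hA]
    calc ∫⁻ x in A, g x ∂(volume.restrict (negOrthant d))
        ≤ ∫⁻ x in A, ((g x - lowerDensity (μ n) x) + lowerDensity (μ n) x)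
            ∂(volume.restrict (negOrthant d)) := lintegral_mono fun x => le_tsub_add
      _ = (∫⁻ x in A, (g x - lowerDensity (μ n) x) ∂(volume.restrict (negOrthant d))) +
            ∫⁻ x in A, lowerDensity (μ n) x ∂(volume.restrict (negOrthant d)) :=
          lintegral_add_right _ (measurable_lowerDensity (μ n))
      _ ≤ _ := by
          refine add_le_add (setLIntegral_le_lintegral _ _) ?_
          refine (lintegral_mono' ?_ le_rfl).trans (setLIntegral_lowerDensity_le (μ n) hA)
          exact Measure.restrict_mono_measure Measure.restrict_le_self A
  have hfin (n : ℕ) : ∫⁻ x in negOrthant d, (g x - lowerDensity (μ n) x) ≠ ⊤ :=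
    ne_top_of_le_ne_top (by simp [hg1]) (lintegral_mono fun x => tsub_le_self)
  have hreal (n : ℕ) (A : Set (Fin d → ℝ)) (hA : MeasurableSet A) :
      (limitLaw μ).real A ≤
        (∫⁻ x in negOrthant d, (g x - lowerDensity (μ n) x)).toReal + (μ n).real A := by
    rw [measureReal_def, measureReal_def, ← ENNReal.toReal_add (hfin n) (measure_ne_top _ _)]
    exact ENNReal.toReal_mono (ENNReal.add_ne_top.2 ⟨hfin n, measure_ne_top _ _⟩) (hle n A hA)
  refine squeeze_zero (fun n => Real.iSup_nonneg fun A => abs_nonneg _) (fun n => ?_)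
    ((ENNReal.tendsto_toReal ENNReal.zero_ne_top).comp hε)
  refine Real.iSup_le (fun ⟨A, hA⟩ => ?_) ENNReal.toReal_nonneg
  have h1 := hreal n A hA
  -- Both measures have mass one, so the complement supplies the reverse inequality.
  have h2 := hreal n Aᶜ hA.compl
  rw [probReal_compl_eq_one_sub hA, probReal_compl_eq_one_sub hA] at h2
  simp only [Function.comp_apply]
  rw [abs_le]
  constructor <;> linarith

end Scheffe

/-! ### Properties of D-norms and the limit of the tail expansion. -/

section DNorm

variable {d : ℕ}

theorem dNorm_integrand_nonneg {x z : Fin d → ℝ} (hz : ∀ j, 0 ≤ z j) : 0 ≤ ⨆ j, |x j| * z j :=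
  Real.iSup_nonneg fun j => mul_nonneg (abs_nonneg _) (hz j)

theorem le_dNorm_integrand (x z : Fin d → ℝ) (i : Fin d) : |x i| * z i ≤ ⨆ j, |x j| * z j :=
  le_ciSup (f := fun j => |x j| * z j) (Set.finite_range _).bddAbove i

theorem dNorm_integrand_le {x y z : Fin d → ℝ} (hz : ∀ j, 0 ≤ z j) :
    ⨆ j, |x j| * z j ≤ (⨆ j, |y j| * z j) + ∑ j, |x j - y j| * z j := by
  have hs (i : Fin d) : |x i - y i| * z i ≤ ∑ j, |x j - y j| * z j :=
    Finset.single_le_sum (f := fun j => |x j - y j| * z j)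
      (fun j _ => mul_nonneg (abs_nonneg _) (hz j)) (Finset.mem_univ i)
  refine Real.iSup_le (fun i => ?_) (add_nonneg (dNorm_integrand_nonneg hz)
    (Finset.sum_nonneg fun j _ => mul_nonneg (abs_nonneg _) (hz j)))
  have h1 : |x i| ≤ |y i| + |x i - y i| := by
    have := abs_add_le (y i) (x i - y i)
    rwa [add_sub_cancel] at this
  have h2 := mul_le_mul_of_nonneg_right h1 (hz i)
  linarith [le_dNorm_integrand y z i, hs i]

theorem integrable_dNorm_integrand {ν : Measure (Fin d → ℝ)}
    (hν : ∀ j, (∀ᵐ z ∂ν, 0 ≤ z j) ∧ Integrable (fun z => z j) ν ∧ ∫ z, z j ∂ν = 1)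
    (x : Fin d → ℝ) : Integrable (fun z : Fin d → ℝ => ⨆ j, |x j| * z j) ν := by
  have hm : Measurable fun z : Fin d → ℝ => ⨆ j, |x j| * z j :=
    Measurable.iSup fun j => (measurable_pi_apply j).const_mul _
  refine (integrable_finsetSum Finset.univ fun j _ => (hν j).2.1.const_mul |x j|).mono'
    hm.aestronglyMeasurable ?_
  filter_upwards [ae_all_iff.2 fun j => (hν j).1] with z hz
  rw [Real.norm_of_nonneg (dNorm_integrand_nonneg hz)]
  simpa using dNorm_integrand_le (x := x) (y := 0) hz

variable {N : (Fin d → ℝ) → ℝ}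

/-- The maximum is subadditive up to a sum over coordinates, and each `Z j` has mean one. This
Lipschitz bound gives continuity. -/
theorem IsDNorm.le_add_sum (hN : IsDNorm N) (x y : Fin d → ℝ) :
    N x ≤ N y + ∑ j, |x j - y j| := by
  obtain ⟨ν, _, hν, hNν⟩ := hN
  have hi (j : Fin d) : Integrable (fun z : Fin d → ℝ => |x j - y j| * z j) ν :=
    (hν j).2.1.const_mul _
  have h1 : ∑ j, |x j - y j| = ∫ z, ∑ j, |x j - y j| * z j ∂ν := by
    rw [integral_finsetSum _ fun j _ => hi j]
    simp [integral_const_mul, (hν _).2.2]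
  rw [hNν, hNν, h1, ← integral_add (integrable_dNorm_integrand hν y)
    (integrable_finsetSum _ fun j _ => hi j)]
  refine integral_mono_ae (integrable_dNorm_integrand hν x)
    ((integrable_dNorm_integrand hν y).add (integrable_finsetSum _ fun j _ => hi j)) ?_
  filter_upwards [ae_all_iff.2 fun j => (hν j).1] with z hz using dNorm_integrand_le hz

theorem IsDNorm.continuous (hN : IsDNorm N) : Continuous N := by
  refine continuous_iff_continuousAt.2 fun x => ?_
  have h : Tendsto (fun y : Fin d → ℝ => ∑ j, |x j - y j|) (𝓝 x) (𝓝 0) := by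
    have : Continuous fun y : Fin d → ℝ => ∑ j, |x j - y j| := by fun_prop
    simpa using this.tendsto x
  refine tendsto_iff_norm_sub_tendsto_zero.2 (squeeze_zero (fun _ => norm_nonneg _) (fun y => ?_) h)
  rw [Real.norm_eq_abs, abs_le]
  have h1 := hN.le_add_sum x y
  have h2 := hN.le_add_sum y x
  simp only [abs_sub_comm (y _) (x _)] at h2
  constructor <;> linarith

theorem IsDNorm.abs_apply_le (hN : IsDNorm N) (x : Fin d → ℝ) (i : Fin d) : |x i| ≤ N x := by
  obtain ⟨ν, _, hν, hNν⟩ := hN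
  calc |x i| = ∫ z, |x i| * z i ∂ν := by rw [integral_const_mul, (hν i).2.2, mul_one]
    _ ≤ N x := by
      rw [hNν]
      exact integral_mono ((hν i).2.1.const_mul _) (integrable_dNorm_integrand hν x)
        fun z => le_dNorm_integrand x z i

theorem IsDNorm.apply_mul {c : ℝ} (hN : IsDNorm N) (hc : 0 ≤ c) (x : Fin d → ℝ) :
    N (fun j => c * x j) = c * N x := by
  obtain ⟨ν, _, hν, hNν⟩ := hN
  rw [hNν, hNν, ← integral_const_mul]
  congr 1
  funext z
  rw [Real.mul_iSup_of_nonneg hc]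
  simp only [abs_mul, abs_of_nonneg hc, mul_assoc]

theorem IsDNorm.apply_neg (hN : IsDNorm N) (x : Fin d → ℝ) : N (-x) = N x := by
  obtain ⟨ν, _, hν, hNν⟩ := hN
  simp [hNν]

theorem IsDNorm.apply_zero (hN : IsDNorm N) : N 0 = 0 := by
  have h := hN.apply_mul le_rfl 0
  rwa [zero_mul, show (fun j => 0 * (0 : Fin d → ℝ) j) = 0 by funext j; simp] at h

/-- At `u = 1 + x/n` homogeneity turns `N (1 - u)` into `N x / n`, while the error is `o(1/n)`;
multiply by `n`. -/
theorem HasTailExpansion.tendsto {C : (Fin d → ℝ) → ℝ} (h : HasTailExpansion C N)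
    (hN : IsDNorm N) {x : Fin d → ℝ} (hx : x ≤ 0) :
    Tendsto (fun n : ℕ => (n : ℝ) * (C (fun j => 1 + x j / n) - 1)) atTop (𝓝 (- N x)) := by
  set u : ℕ → Fin d → ℝ := fun n j => 1 + x j / n
  have hu : Tendsto u atTop (𝓝[Set.Icc 0 1] 1) := by
    refine tendsto_nhdsWithin_iff.2 ⟨tendsto_pi_nhds.2 fun j => ?_, ?_⟩
    · simpa [u] using (tendsto_const_div_atTop_nhds_zero_nat (x j)).const_add 1
    · have h1 : ∀ᶠ n : ℕ in atTop, ∀ j, -x j ≤ n := eventually_all.2 fun j =>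
        tendsto_natCast_atTop_atTop.eventually_ge_atTop (-x j)
      filter_upwards [h1, eventually_gt_atTop 0] with n hn hn0
      have hn0' : (0 : ℝ) < n := by exact_mod_cast hn0
      refine ⟨fun j => ?_, fun j => ?_⟩
      · have : -1 ≤ x j / n := by
          rw [le_div_iff₀ hn0']
          linarith [hn j]
        simp only [Pi.zero_apply, u]
        linarith
      · have : x j / n ≤ 0 := div_nonpos_of_nonpos_of_nonneg (hx j) hn0'.le
        simp only [Pi.one_apply, u]
        linarith
  have h1 : (fun n => C (u n) - (1 - N (1 - u n))) =o[atTop] fun n => 1 - u n := h.comp_tendsto hu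
  have h2 : (fun n => 1 - u n) =O[atTop] fun n : ℕ => (1 : ℝ) / n := by
    refine IsBigO.of_bound ‖x‖ (.of_forall fun n => ?_)
    rw [show 1 - u n = (1 / (n : ℝ)) • (-x) by
      funext j
      simp only [Pi.sub_apply, Pi.one_apply, Pi.smul_apply, Pi.neg_apply, smul_eq_mul, u]
      ring, norm_smul, norm_neg, mul_comm]
  have h3 := (h1.trans_isBigO h2).tendsto_div_nhds_zero
  refine (by simpa using h3.sub_const (N x) : Tendsto _ _ (𝓝 (- N x))).congr' ?_
  filter_upwards [eventually_gt_atTop 0] with n hn0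
  have hn0' : (0 : ℝ) < n := by exact_mod_cast hn0
  have h4 : N (1 - u n) = 1 / (n : ℝ) * N x := by
    rw [← hN.apply_neg x, ← hN.apply_mul (by positivity)]
    congr 1
    funext j
    simp only [Pi.sub_apply, Pi.one_apply, Pi.neg_apply, u]
    ring
  rw [h4]
  change (C (u n) - (1 - 1 / (n : ℝ) * N x)) * (n : ℝ) - N x = n * (C (u n) - 1)
  generalize C (u n) = c
  field_simp
  ring

end DNorm

/-! ### Derivatives of the powers approximating the exponential. -/

section PowerDerivatives

/-- The `k`-th derivative of `s ↦ (1 + s / n) ^ n`. -/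
noncomputable def expApprox (n k : ℕ) (s : ℝ) : ℝ :=
  (n.descFactorial k : ℝ) / (n : ℝ) ^ k * (1 + s / n) ^ (n - k)

/-- For `k ≥ n` the truncated exponent is harmless: the factor `n - k` makes both derivatives zero.
-/
theorem hasDerivAt_expApprox (n k : ℕ) (s : ℝ) :
    HasDerivAt (expApprox n k) (expApprox n (k + 1) s) s := by
  have h1 : HasDerivAt (fun s : ℝ => 1 + s / n) (1 / n) s :=
    ((hasDerivAt_id s).div_const _).const_add _
  refine ((h1.pow (n - k)).const_mul ((n.descFactorial k : ℝ) / (n : ℝ) ^ k)).congr_deriv ?_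
  rw [expApprox, Nat.descFactorial_succ, Nat.sub_sub]
  push_cast
  rw [pow_succ]
  field_simp

/-- The limit does not depend on `k`, as every derivative of `exp` is `exp`. -/
theorem tendsto_expApprox {φ : ℕ → ℝ} {c : ℝ} (hφ : Tendsto φ atTop (𝓝 c)) (k : ℕ) :
    Tendsto (fun n => expApprox n k (φ n)) atTop (𝓝 (Real.exp c)) := by
  have h1 : Tendsto (fun n : ℕ => (n.descFactorial k : ℝ) / (n : ℝ) ^ k) atTop (𝓝 1) := by
    refine (isEquivalent_iff_tendsto_one ?_).1 (isEquivalent_descFactorial k)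
    filter_upwards [eventually_gt_atTop 0] with n hn
    positivity
  have h2 : Tendsto (fun n : ℕ => (1 + φ n / n) ^ n) atTop (𝓝 (Real.exp c)) := by
    refine Real.tendsto_one_add_pow_exp_of_tendsto (hφ.congr' ?_)
    filter_upwards [eventually_gt_atTop 0] with n hn
    field_simp
  have h3 : Tendsto (fun n : ℕ => 1 + φ n / n) atTop (𝓝 1) := by
    simpa using (hφ.div_atTop tendsto_natCast_atTop_atTop).const_add 1
  have h4 := h1.mul (h2.div (h3.pow k) (by simp))
  simp only [one_pow, div_one, one_mul, Pi.div_apply] at h4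
  refine h4.congr' ?_
  filter_upwards [eventually_ge_atTop k, h3.eventually_ne one_ne_zero] with n hn hne
  rw [expApprox, pow_sub₀ _ hne hn, div_eq_mul_inv (_ ^ n)]

end PowerDerivatives

/-! ### The law of the normalised maxima. -/

section Maxima

theorem componentwiseMax_le_iff {d : ℕ} {Ω : Type*} {U : ℕ → Ω → (Fin d → ℝ)} {n : ℕ} (hn : 0 < n) {ω : Ω} {x : Fin d → ℝ} :
    (fun j => (n : ℝ) * (componentwiseMax U n ω j - 1)) ≤ x ↔
      ∀ i : Fin n, U i ω ≤ fun j => 1 + x j / n := by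
  have hn' : (0 : ℝ) < n := by exact_mod_cast hn
  have : Nonempty (Fin n) := ⟨⟨0, hn⟩⟩
  have key (j : Fin d) : (n : ℝ) * (componentwiseMax U n ω j - 1) ≤ x j ↔
      ∀ i : Fin n, U i ω j ≤ 1 + x j / n := by
    rw [← ciSup_le_iff (Set.finite_range _).bddAbove, mul_comm, ← le_div_iff₀ hn',
      sub_le_iff_le_add']
    rfl
  simp only [Pi.le_def, key]
  exact forall_comm

variable {d : ℕ} {Ω : Type*} [MeasurableSpace Ω] {P : Measure Ω} {U : ℕ → Ω → (Fin d → ℝ)}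

theorem measurable_componentwiseMax (hU : ∀ i, Measurable (U i)) (n : ℕ) :
    Measurable fun ω (j : Fin d) => (n : ℝ) * (componentwiseMax U n ω j - 1) := by
  refine measurable_pi_lambda _ fun j => Measurable.const_mul (Measurable.sub_const ?_ _) _
  exact Measurable.iSup fun i => (measurable_pi_apply j).comp (hU i)

theorem measureReal_map_componentwiseMax (hU : ∀ i, Measurable (U i)) (hind : iIndepFun U P)
    {C : (Fin d → ℝ) → ℝ} (hC : ∀ i u, P.real {ω | U i ω ≤ u} = C u) {n : ℕ} (hn : 0 < n)
    (x : Fin d → ℝ) :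
    (P.map fun ω (j : Fin d) => (n : ℝ) * (componentwiseMax U n ω j - 1)).real (Set.Iic x) =
      C (fun j => 1 + x j / n) ^ n := by
  rw [map_measureReal_apply (measurable_componentwiseMax hU n) measurableSet_Iic]
  have h1 : (fun ω (j : Fin d) => (n : ℝ) * (componentwiseMax U n ω j - 1)) ⁻¹' Set.Iic x =
      ⋂ i ∈ Finset.range n, U i ⁻¹' Set.Iic (fun j => 1 + x j / n) := by
    ext ω
    simp only [Set.mem_preimage, Set.mem_Iic, componentwiseMax_le_iff hn, Set.mem_iInter,
      Finset.mem_range]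
    exact ⟨fun h i hi => h ⟨i, hi⟩, fun h i => h i i.2⟩
  rw [h1, measureReal_def, hind.measure_inter_preimage_eq_mul _ fun _ _ => measurableSet_Iic,
    ENNReal.toReal_prod]
  have h2 (i : ℕ) : (P (U i ⁻¹' Set.Iic fun j => 1 + x j / n)).toReal =
      C (fun j => 1 + x j / n) := hC i _
  simp [h2]

end Maxima

/-! ### Assembly of the main theorem. -/

section Main

variable {d : ℕ}

/-- Blocks from Faà di Bruno's formula are increasing, which is the order of differentiation in the
hypothesis on partial derivatives. -/
theorem sort_toFinset_of_sublist_finRange {B : List (Fin d)} (h : B.Sublist (List.finRange d)) :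
    B.toFinset.sort (· ≤ ·) = B :=
  (List.toFinset_sort (· ≤ ·) (h.nodup (List.nodup_finRange d))).2
    ((List.pairwise_le_finRange d).sublist h)

theorem MixedPartialsConverge.exists_of_sublist {C N : (Fin d → ℝ) → ℝ}
    (h : MixedPartialsConverge C N) (hN : IsDNorm N) (hexp : HasTailExpansion C N)
    {B : List (Fin d)} (hB : B.Sublist (List.finRange d)) {x : Fin d → ℝ} (hx : ∀ j, x j < 0) :
    (∃ v, HasMixedPartial (fun y => - N y) B x v) ∧
      (∀ᶠ n : ℕ in atTop, ∃ v,
        HasMixedPartial (fun y => (n : ℝ) * (C (fun j => 1 + y j / n) - 1)) B x v) ∧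
      Tendsto
        (fun n : ℕ => mixedPartial (fun y => (n : ℝ) * (C (fun j => 1 + y j / n) - 1)) B x) atTop
        (𝓝 (mixedPartial (fun y => - N y) B x)) := by
  rcases eq_or_ne B [] with rfl | hne
  -- The empty block, absent from that hypothesis, is the tail expansion.
  · refine ⟨⟨_, rfl⟩, .of_forall fun n => ⟨_, rfl⟩, ?_⟩
    simpa using hexp.tendsto hN fun j => (hx j).le
  · obtain ⟨v, w, hv, hw, hvw⟩ := h B.toFinset (by simpa using hne) x hx
    rw [sort_toFinset_of_sublist_finRange hB] at hw
    simp only [sort_toFinset_of_sublist_finRange hB] at hv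
    refine ⟨⟨w, hw⟩, hv.mono fun n hn => ⟨_, hn⟩, ?_⟩
    rw [hw.mixedPartial_eq]
    exact hvw.congr' (hv.mono fun n hn => hn.mixedPartial_eq.symm)

end Main

theorem mainTheorem2 {d : ℕ} {Ω : Type*} [MeasurableSpace Ω] (P : Measure Ω)
    [IsProbabilityMeasure P] (C N : (Fin d → ℝ) → ℝ) (hC : IsCopula C) (hN : IsDNorm N)
    (U : ℕ → Ω → (Fin d → ℝ)) (hUmeas : ∀ i, Measurable (U i)) (hUindep : iIndepFun U P)
    (hUcdf : ∀ i u, P.real {ω | U i ω ≤ u} = C u)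
    (hexp : HasTailExpansion C N) (hder : MixedPartialsConverge C N) :
    ∃ G : Measure (Fin d → ℝ), IsProbabilityMeasure G ∧
      (∀ x : Fin d → ℝ, x ≤ 0 → G.real (Set.Iic x) = Real.exp (- N x)) ∧
      Tendsto
        (fun n : ℕ => ⨆ A : {A : Set (Fin d → ℝ) // MeasurableSet A},
          |P.real {ω | (fun j => (n : ℝ) * (componentwiseMax U n ω j - 1)) ∈ A.1} - G.real A.1|)
        atTop (𝓝 0) := by
  set μ : ℕ → Measure (Fin d → ℝ) := fun n =>
    P.map fun ω (j : Fin d) => (n : ℝ) * (componentwiseMax U n ω j - 1) with hμ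
  have hμp (n : ℕ) : IsProbabilityMeasure (μ n) :=
    Measure.isProbabilityMeasure_map (measurable_componentwiseMax hUmeas n).aemeasurable
  set φ : ℕ → (Fin d → ℝ) → ℝ := fun n y => (n : ℝ) * (C (fun j => 1 + y j / n) - 1) with hφ
  set E : (Fin d → ℝ) → ℝ := fun y => Real.exp (- N y) with hE
  have hF {n : ℕ} (hn : 0 < n) :
      (fun y => (μ n).real (Set.Iic y)) = fun y => expApprox n 0 (φ n y) := by
    funext y
    have hn' : (n : ℝ) ≠ 0 := by positivity
    rw [hμ, measureReal_map_componentwiseMax hUmeas hUindep hUcdf hn, expApprox, hφ]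
    simp only [Nat.descFactorial_zero, pow_zero, Nat.sub_zero]
    field_simp
    simp
  have hcdf : ∀ x ≤ 0, Tendsto (fun n => (μ n).real (Set.Iic x)) atTop (𝓝 (E x)) := by
    intro x hx
    refine (tendsto_expApprox (hexp.tendsto hN hx) 0).congr' ?_
    filter_upwards [eventually_gt_atTop 0] with n hn
    exact (congrFun (hF hn) x).symm
  have hEpart (l : List (Fin d)) (hl : l.Sublist (List.finRange d)) (x : Fin d → ℝ)
      (hx : ∀ j, x j < 0) : HasMixedPartial E l x
        (faaDiBrunoSum (fun _ => Real.exp (- N x)) (fun B => mixedPartial (fun y => - N y) B x) l) :=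
    hasMixedPartial_comp (H := fun _ => Real.exp) (fun _ => Real.hasDerivAt_exp)
      fun B hB => (hder.exists_of_sublist hN hexp (hB.trans hl) hx).1
  have hEex : ∀ l, l <:+ List.finRange d → ∀ x : Fin d → ℝ, (∀ j, x j < 0) →
      ∃ v, HasMixedPartial E l x v := fun l hl x hx => ⟨_, hEpart l hl.sublist x hx⟩
  have hpart : ∀ x : Fin d → ℝ, (∀ j, x j < 0) → ∃ v : ℕ → ℝ,
      (∀ᶠ n in atTop, HasMixedPartial (fun y => (μ n).real (Set.Iic y)) (List.finRange d) x (v n)) ∧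
        Tendsto v atTop (𝓝 (mixedPartial E (List.finRange d) x)) := by
    intro x hx
    refine ⟨fun n => faaDiBrunoSum (fun k => expApprox n k (φ n x))
      (fun B => mixedPartial (φ n) B x) (List.finRange d), ?_, ?_⟩
    · have h : ∀ᶠ n : ℕ in atTop, ∀ B ∈ {B : List (Fin d) | B ∈ (List.finRange d).sublists},
          ∃ v, HasMixedPartial (φ n) B x v :=
        (eventually_all_finite (List.finite_toSet _)).2 fun B hB =>
          (hder.exists_of_sublist hN hexp (List.mem_sublists.1 hB) hx).2.1
      filter_upwards [h, eventually_gt_atTop 0] with n hn hn0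
      rw [hF hn0]
      exact hasMixedPartial_comp (hasDerivAt_expApprox n) fun B hB =>
        hn B (List.mem_sublists.2 hB)
    · rw [(hEpart _ (List.Sublist.refl _) x hx).mixedPartial_eq]
      exact tendsto_faaDiBrunoSum
        (fun k => tendsto_expApprox (hexp.tendsto hN fun j => (hx j).le) k)
        fun B hB => (hder.exists_of_sublist hN hexp hB hx).2.2
  have hEc : Continuous E := Real.continuous_exp.comp hN.continuous.neg
  -- Mean one of `Z i` gives `N z ≥ |z i|`.
  have hEle : ∀ z ≤ 0, ∀ i, E z ≤ Real.exp (z i) := fun z hz i =>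
    Real.exp_le_exp.2 (by linarith [hN.abs_apply_le z i, neg_abs_le (z i)])
  have hG {x : Fin d → ℝ} (hx : x ≤ 0) : limitLaw μ (Set.Iic x) = ENNReal.ofReal (E x) :=
    limitLaw_Iic hcdf hEex hpart hEc hEle hx
  have hGp : IsProbabilityMeasure (limitLaw μ) :=
    isProbabilityMeasure_limitLaw (by simp [hE, hN.apply_zero]) (hG le_rfl)
  refine ⟨limitLaw μ, hGp, fun x hx => ?_, ?_⟩
  · rw [measureReal_def, hG hx, ENNReal.toReal_ofReal (Real.exp_pos _).le]
  · refine (tendsto_iSup_abs_sub_limitLaw hpart).congr fun n => ?_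
    congr 1
    funext A
    rw [hμ, map_measureReal_apply (measurable_componentwiseMax hUmeas n) A.2]
    rfl
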